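/- For a finite field $\mathbb F_q$ and $x\in\mathbb F_q^2$ write $\|x\|=x_1^2+x_2^2$; for $t\in\mathbb F_q^*$ let $S_t=\{x\in\mathbb F_q^2:\|x\|=t\}$, and write $S_t(\cdot)$ also for its indicator function. For $f:\mathbb F_q^2\to\mathbb R$ put $\|f\|_p=\big(q^{-2}\sum_{x}|f(x)|^p\big)^{1/p}$ if $1\le p<\infty$, and $\|f\|_\infty=\max_x|f(x)|$. For non-negative $f_1,\dots,f_4:\mathbb F_q^2\to\mathbb R$ define the ($C_4$ + diagonal)-form $$\diamondsuit_t(f_1,f_2,f_3,f_4)=\frac1{q^2|S_t|}\sum_{x^1,x^2,x^3,x^4\in\mathbb F_q^2}S_t(x^1-x^2)S_t(x^2-x^3)S_t(x^3-x^4)S_t(x^4-x^1)S_t(x^1-x^3)\prod_{i=1}^4f_i(x^i).$$ For $1\le p_1,\dots,p_4\le\infty$, write $\diamondsuit_t(p_1,p_2,p_3,p_4)\lesssim1$ if there is a constant $C>0$ such that $$\diamondsuit_t(f_1,f_2,f_3,f_4)\le C\,\|f_1\|_{p_1}\|f_2\|_{p_2}\|f_3\|_{p_3}\|f_4\|_{p_4}$$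 for all finite fields $\mathbb F_q$ in which $3$ is a square, all $t\in\mathbb F_q^*$ and all non-negative $f_1,\dots,f_4$ on $\mathbb F_q^2$. Write $\diamondsuit_t(p_1,p_2,p_3,p_4)\lessapprox1$ (restricted strong type) if the same holds whenever $f_1,\dots,f_4$ are indicator functions of subsets of $\mathbb F_q^2$. **Theorem.** Let $1\le p_1,p_2,p_3,p_4\le\infty$, with the convention $1/\infty=0$, and consider the conditions $$\frac1{p_1}+\frac1{p_2}+\frac2{p_3}+\frac1{p_4}\le2,\qquad \frac2{p_1}+\frac1{p_2}+\frac1{p_3}+\frac1{p_4}\le2,\qquad \frac1{p_1}+\frac2{p_2}+\frac1{p_3}+\frac2{p_4}\le2.\tag{$*$}$$ (i) If $\diamondsuit_t(p_1,p_2,p_3,p_4)\lesssim1$, then $(*)$ holds. (ii) Conversely, if $(*)$ holds and $(p_1,p_2,p_3,p_4)$ is neither $(2,2,2,\infty)$ nor $(2,\infty,2,2)$, then $\diamondsuit_t(p_1,p_2,p_3,p_4)\lesssim1$. (iii) At the two remaining points, $\diamondsuit_t(2,\infty,2,2)\lessapprox1$ and $\diamondsuit_t(2,2,2,\infty)\lessapprox1$.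 -/

import Mathlib

open scoped ENNReal

noncomputable section

namespace DiamondForm

/-- The quadratic form `‖x‖ = x₁² + x₂²` on the plane `F²`. -/
def quadNorm {F : Type} [Field F] (x : Fin 2 → F) : F := ∑ i, x i ^ 2

/-- The circle `S_t = {x ∈ F² : ‖x‖ = t}`. -/
def circle {F : Type} [Field F] (t : F) : Set (Fin 2 → F) := {x | quadNorm x = t}

/-- The indicator function of `S_t`. -/
def circleInd {F : Type} [Field F] (t : F) : (Fin 2 → F) → ℝ := (circle t).indicator 1

/-- The `L^p` norm on `F²` with respect to normalized counting measure, `1 ≤ p ≤ ∞`: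
`(q⁻² ∑ₓ |f x|^p)^(1/p)` for finite `p`, and `max |f|` for `p = ∞`. -/
def lpNorm {F : Type} [Field F] [Fintype F] (p : ℝ≥0∞) (f : (Fin 2 → F) → ℝ) : ℝ :=
  if p = ∞ then ⨆ x, |f x|
  else (((Fintype.card F : ℝ) ^ 2)⁻¹ * ∑ x, |f x| ^ p.toReal) ^ (1 / p.toReal)

/-- The form `♦_t(f₁, f₂, f₃, f₄)` on `F²`, attached to the 4-cycle `x¹x²x³x⁴` together with the
diagonal `x¹x³`. The normalizing factor is `q² |S_t|`: in the plane the factor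
`|S_t^{d-2}| ∼ q^{d-2}` that occurs in dimension `d` is taken to be `1`. -/
def diamond {F : Type} [Field F] [Fintype F] (t : F) (f₁ f₂ f₃ f₄ : (Fin 2 → F) → ℝ) : ℝ :=
  ((Fintype.card F : ℝ) ^ 2 * ((circle t).ncard : ℝ))⁻¹ *
    ∑ x₁, ∑ x₂, ∑ x₃, ∑ x₄,
      circleInd t (x₁ - x₂) * circleInd t (x₂ - x₃) * circleInd t (x₃ - x₄) *
        circleInd t (x₄ - x₁) * circleInd t (x₁ - x₃) *
        (f₁ x₁ * f₂ x₂ * f₃ x₃ * f₄ x₄)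

/-- `♦_t(p₁, p₂, p₃, p₄) ≲ 1`: the estimate
`♦_t(f₁, f₂, f₃, f₄) ≤ C ‖f₁‖_{p₁} ‖f₂‖_{p₂} ‖f₃‖_{p₃} ‖f₄‖_{p₄}` holds for all non-negative `fᵢ`
with one constant `C` for all finite fields in which `3` is a square and all `t ≠ 0`. -/
def Bounded (p₁ p₂ p₃ p₄ : ℝ≥0∞) : Prop :=
  ∃ C : ℝ, 0 < C ∧
    ∀ (F : Type) [Field F] [Fintype F], IsSquare (3 : F) → ∀ t : F, t ≠ 0 →
      ∀ f₁ f₂ f₃ f₄ : (Fin 2 → F) → ℝ,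
        (∀ x, 0 ≤ f₁ x) → (∀ x, 0 ≤ f₂ x) → (∀ x, 0 ≤ f₃ x) → (∀ x, 0 ≤ f₄ x) →
        diamond t f₁ f₂ f₃ f₄ ≤
          C * (lpNorm p₁ f₁ * lpNorm p₂ f₂ * lpNorm p₃ f₃ * lpNorm p₄ f₄)

/-- The restricted strong-type estimate `♦_t(p₁, p₂, p₃, p₄) ⪅ 1`: the same estimate for
indicator functions of arbitrary subsets of `F²`. -/
def RestrictedBounded (p₁ p₂ p₃ p₄ : ℝ≥0∞) : Prop :=
  ∃ C : ℝ, 0 < C ∧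
    ∀ (F : Type) [Field F] [Fintype F], IsSquare (3 : F) → ∀ t : F, t ≠ 0 →
      ∀ E₁ E₂ E₃ E₄ : Set (Fin 2 → F),
        diamond t (E₁.indicator 1) (E₂.indicator 1) (E₃.indicator 1) (E₄.indicator 1) ≤
          C * (lpNorm p₁ (E₁.indicator 1) * lpNorm p₂ (E₂.indicator 1) *
            lpNorm p₃ (E₃.indicator 1) * lpNorm p₄ (E₄.indicator 1))

/-- The three necessary conditions on the exponents, in dimension `d = 2`
(with `1/∞ = 0`). -/
def NecessaryConditions (p₁ p₂ p₃ p₄ : ℝ≥0∞) : Prop :=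
  1 / p₁ + 1 / p₂ + 2 / p₃ + 1 / p₄ ≤ 2 ∧
  2 / p₁ + 1 / p₂ + 1 / p₃ + 1 / p₄ ≤ 2 ∧
  1 / p₁ + 2 / p₂ + 1 / p₃ + 2 / p₄ ≤ 2

end DiamondForm

end

/-!
Outside characteristic two, where there are no triangles at all, two distinct circles `x + S_t` and
`y + S_t` meet in at most two points. So `w x y = S_t(x - y)` is a kernel with degrees `O(q)` and
bounded codegrees, and summing out one of `x², x⁴` costs only a constant: as `f₂ ^ a₂ * f₄ ^ a₄` is
bounded by `f₂ ^ (a₂ + a₄) + f₄ ^ (a₂ + a₄)`, what remains is a triangle form with exponents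
`(a₁, a₂ + a₄, a₃)`.

For functions of mean one, with exponents in the place of norms, the triangle form can be
interpolated pointwise by the weighted AM-GM inequality, even at the endpoints, between the
exponents `(0, 0, 0)`, `(1, 0, 0)`, `(2/3, 2/3, 0)` and `(1/2, 1/2, 1/2)`. The third one is an
estimate for the edge form, where Hölder is applied after the largest term of each neighbourhood
is split off, so that the other terms are controlled by pairs of distinct points and hence by
codegrees. The last one is a Schur test in the neighbourhood of each vertex, made off-diagonal by
averaging over random cuts. As this endpoint is reached in the strong form, so are `(2, 2, 2, ∞)`
and `(2, ∞, 2, 2)`.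

For the necessity, let `q = 3ⁿ`. Any two distinct elements of `{0, 1, -1}` differ by a square
root of `1`, so a proper 3-colouring `e` of the diamond graph yields the configurations
`(e₁ v, e₂ v, e₃ v, e₄ v)`, `v ∈ S₁`. Testing on the indicators of `eᵢ • S₁` and letting `n → ∞`
bounds the sum of the `codim (eᵢ • S₁) / pᵢ` by `2`; the three colourings with a different vertex
class at the origin give the three conditions.
-/

noncomputable section

namespace DiamondForm

open Finset

section Inequalities

variable {ι κ : Type*}

theorem cube_sum_mul_mul_sq_le (s : Finset ι) {w u v : ι → ℝ} (hw : ∀ i ∈ s, 0 ≤ w i)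
    (hu : ∀ i ∈ s, 0 ≤ u i) (hv : ∀ i ∈ s, 0 ≤ v i) :
    (∑ i ∈ s, w i * (u i * v i ^ 2)) ^ 3 ≤
      (∑ i ∈ s, w i * u i ^ 3) * (∑ i ∈ s, w i * v i ^ 3) ^ 2 := by
  set S := ∑ i ∈ s, w i * (u i * v i ^ 2)
  set M := ∑ i ∈ s, w i * (u i ^ 2 * v i)
  set P := ∑ i ∈ s, w i * u i ^ 3
  set Q := ∑ i ∈ s, w i * v i ^ 3
  have hS : 0 ≤ S := sum_nonneg fun i hi =>
    mul_nonneg (hw i hi) (mul_nonneg (hu i hi) (sq_nonneg _))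
  have hP : 0 ≤ P := sum_nonneg fun i hi => mul_nonneg (hw i hi) (pow_nonneg (hu i hi) 3)
  have hSM : S ^ 2 ≤ Q * M := sum_sq_le_sum_mul_sum_of_sq_le_mul s
    (fun i hi => mul_nonneg (hw i hi) (pow_nonneg (hv i hi) 3))
    (fun i hi => mul_nonneg (hw i hi) (mul_nonneg (sq_nonneg _) (hv i hi)))
    (fun i _ => le_of_eq (by ring))
  have hMS : M ^ 2 ≤ P * S := sum_sq_le_sum_mul_sum_of_sq_le_mul s
    (fun i hi => mul_nonneg (hw i hi) (pow_nonneg (hu i hi) 3))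
    (fun i hi => mul_nonneg (hw i hi) (mul_nonneg (hu i hi) (sq_nonneg _)))
    (fun i _ => le_of_eq (by ring))
  rcases hS.eq_or_lt with h0 | hpos
  · rw [← h0, zero_pow three_ne_zero]
    positivity
  · refine le_of_mul_le_mul_right ?_ hpos
    calc S ^ 3 * S = (S ^ 2) ^ 2 := by ring
      _ ≤ (Q * M) ^ 2 := by gcongr
      _ = Q ^ 2 * M ^ 2 := by ring
      _ ≤ Q ^ 2 * (P * S) := by gcongr
      _ = P * Q ^ 2 * S := by ring

theorem sq_sum_eq_sum_sq_add_sum_offDiag (s : Finset ι) (k : ι → ℝ) :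
    (∑ i ∈ s, k i) ^ 2 = ∑ i ∈ s, k i ^ 2 + ∑ p ∈ s.offDiag, k p.1 * k p.2 := by
  classical
  rw [sq, sum_mul_sum, ← sum_product', ← diag_union_offDiag,
    sum_union (disjoint_diag_offDiag s), sum_diag]
  simp only [sq]

theorem sq_sum_erase_le_sum_offDiag [DecidableEq ι] {s : Finset ι} {k : ι → ℝ}
    (hk : ∀ i ∈ s, 0 ≤ k i) {m : ι} (hm : m ∈ s) (hmax : ∀ i ∈ s, k i ≤ k m) :
    (∑ i ∈ s.erase m, k i) ^ 2 ≤ ∑ p ∈ s.offDiag, k p.1 * k p.2 := by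
  have hsq : ∑ i ∈ s.erase m, k i ^ 2 ≤ k m * ∑ i ∈ s.erase m, k i := by
    rw [mul_sum]
    refine sum_le_sum fun i hi => ?_
    rw [sq]
    exact mul_le_mul_of_nonneg_right (hmax i (mem_of_mem_erase hi))
      (hk i (mem_of_mem_erase hi))
  have hrest : 0 ≤ k m * ∑ i ∈ s.erase m, k i := mul_nonneg (hk m hm)
    (sum_nonneg fun i hi => hk i (mem_of_mem_erase hi))
  have hexpand := sq_sum_eq_sum_sq_add_sum_offDiag s k
  rw [← add_sum_erase s k hm, ← add_sum_erase s (fun i => k i ^ 2) hm] at hexpand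
  linarith

theorem cube_add_le_four_mul {a b : ℝ} (ha : 0 ≤ a) (hb : 0 ≤ b) :
    (a + b) ^ 3 ≤ 4 * (a ^ 3 + b ^ 3) := by
  simpa [show (2 : ℝ) ^ (3 - 1) = 4 by norm_num] using add_pow_le ha hb 3

/-- The pure powers `c⁶` appear only once: the largest term of `∑ w c³` is split off, and what
remains is controlled by pairs of distinct indices. -/
theorem cube_sum_mul_sq_le (s : Finset ι) {w c : ι → ℝ} (hw : ∀ i ∈ s, 0 ≤ w i)
    (hw' : ∀ i ∈ s, w i ≤ 1) (hc : ∀ i ∈ s, 0 ≤ c i) :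
    (∑ i ∈ s, w i * c i ^ 2) ^ 3 ≤ 4 * (∑ i ∈ s, w i * c i ^ 6 +
      (∑ i ∈ s, w i) * ∑ p ∈ s.offDiag, w p.1 * c p.1 ^ 3 * (w p.2 * c p.2 ^ 3)) := by
  classical
  rcases s.eq_empty_or_nonempty with rfl | hs
  · simp
  obtain ⟨m, hm, hmax⟩ := s.exists_max_image (fun i => w i * c i ^ 3) hs
  have hk : ∀ i ∈ s, 0 ≤ w i * c i ^ 3 := fun i hi => mul_nonneg (hw i hi) (pow_nonneg (hc i hi) 3)
  have herase : ∀ i ∈ s.erase m, i ∈ s := fun i => mem_of_mem_erase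
  have hmain : (w m * c m ^ 2) ^ 3 ≤ ∑ i ∈ s, w i * c i ^ 6 :=
    calc (w m * c m ^ 2) ^ 3 = w m ^ 3 * c m ^ 6 := by ring
      _ ≤ w m * c m ^ 6 := by
        gcongr
        exact pow_le_of_le_one (hw m hm) (hw' m hm) three_ne_zero
      _ ≤ ∑ i ∈ s, w i * c i ^ 6 := single_le_sum (f := fun i => w i * c i ^ 6)
        (fun i hi => mul_nonneg (hw i hi) (pow_nonneg (hc i hi) 6)) hm
  have hrest : (∑ i ∈ s.erase m, w i * c i ^ 2) ^ 3 ≤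
      (∑ i ∈ s, w i) * ∑ p ∈ s.offDiag, w p.1 * c p.1 ^ 3 * (w p.2 * c p.2 ^ 3) :=
    calc (∑ i ∈ s.erase m, w i * c i ^ 2) ^ 3
        ≤ (∑ i ∈ s.erase m, w i) * (∑ i ∈ s.erase m, w i * c i ^ 3) ^ 2 := by
          simpa only [one_mul, one_pow, mul_one] using cube_sum_mul_mul_sq_le (s.erase m)
            (u := fun _ => 1) (fun i hi => hw i (herase i hi)) (fun _ _ => zero_le_one)
            fun i hi => hc i (herase i hi)
      _ ≤ _ := mul_le_mul
        (sum_le_sum_of_subset_of_nonneg (s.erase_subset m) fun i hi _ => hw i hi)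
        (sq_sum_erase_le_sum_offDiag hk hm hmax) (sq_nonneg _) (sum_nonneg hw)
  rw [← add_sum_erase s (fun i => w i * c i ^ 2) hm]
  refine (cube_add_le_four_mul (mul_nonneg (hw m hm) (sq_nonneg _)) (sum_nonneg fun i hi =>
    mul_nonneg (hw i (herase i hi)) (sq_nonneg _))).trans ?_
  gcongr

theorem sq_sum_sum_mul_mul_le (s : Finset ι) (t : Finset κ) {k : ι → κ → ℝ}
    (hk : ∀ i ∈ s, ∀ j ∈ t, 0 ≤ k i j) (f : ι → ℝ) (g : κ → ℝ) :
    (∑ i ∈ s, ∑ j ∈ t, k i j * (f i * g j)) ^ 2 ≤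
      (∑ i ∈ s, (∑ j ∈ t, k i j) * f i ^ 2) * ∑ j ∈ t, (∑ i ∈ s, k i j) * g j ^ 2 := by
  have hf : ∑ i ∈ s, (∑ j ∈ t, k i j) * f i ^ 2 =
      ∑ p ∈ s ×ˢ t, k p.1 p.2 * f p.1 ^ 2 := by
    simp only [sum_product, sum_mul]
  have hg : ∑ j ∈ t, (∑ i ∈ s, k i j) * g j ^ 2 =
      ∑ p ∈ s ×ˢ t, k p.1 p.2 * g p.2 ^ 2 := by
    simp only [sum_product_right, sum_mul]
  rw [hf, hg, ← sum_product' s t fun i j => k i j * (f i * g j)]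
  have hnonneg : ∀ p ∈ s ×ˢ t, 0 ≤ k p.1 p.2 := fun p hp =>
    hk p.1 (mem_product.mp hp).1 p.2 (mem_product.mp hp).2
  exact sum_sq_le_sum_mul_sum_of_sq_le_mul _
    (fun p hp => mul_nonneg (hnonneg p hp) (sq_nonneg _))
    (fun p hp => mul_nonneg (hnonneg p hp) (sq_nonneg _)) fun p _ => le_of_eq (by ring)

variable [Fintype ι]

theorem card_filter_mem_notMem [DecidableEq ι] {x y : ι} (hxy : x ≠ y) :
    4 * #{A : Finset ι | x ∈ A ∧ y ∉ A} = 2 ^ Fintype.card ι := by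
  have hIcc : ({A : Finset ι | x ∈ A ∧ y ∉ A} : Finset (Finset ι)) = Finset.Icc {x} {y}ᶜ := by
    ext A
    simp [mem_Icc, subset_compl_singleton]
  have hcard : 2 ≤ Fintype.card ι := Fintype.one_lt_card_iff.mpr ⟨x, y, hxy⟩
  rw [hIcc, card_Icc_finset (by simpa using hxy.symm), card_compl, card_singleton,
    card_singleton, show (4 : ℕ) = 2 ^ 2 from rfl, ← pow_add]
  congr 1
  omega

/-- A uniformly random cut `(A, Aᶜ)` separates `x` from `y`, in this order, with
probability `1/4`. -/
theorem four_mul_sum_cut [DecidableEq ι] (φ : ι → ι → ℝ) :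
    4 * ∑ A : Finset ι, ∑ x ∈ A, ∑ y ∈ Aᶜ, φ x y =
      2 ^ Fintype.card ι * ∑ p ∈ (univ : Finset ι).offDiag, φ p.1 p.2 := by
  have hcut : ∀ A : Finset ι, ∑ x ∈ A, ∑ y ∈ Aᶜ, φ x y =
      ∑ p ∈ (univ : Finset ι).offDiag, if p.1 ∈ A ∧ p.2 ∉ A then φ p.1 p.2 else 0 := by
    intro A
    rw [← sum_product', ← sum_filter]
    refine sum_congr ?_ fun _ _ => rfl
    ext ⟨x, y⟩
    simp only [mem_product, mem_compl, mem_filter, mem_offDiag,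
      mem_univ, true_and]
    exact ⟨fun h => ⟨fun hxy => h.2 (hxy ▸ h.1), h⟩, And.right⟩
  simp only [hcut]
  rw [sum_comm, mul_sum, mul_sum]
  refine sum_congr rfl fun p hp => ?_
  rw [← sum_filter, sum_const, nsmul_eq_mul, ← mul_assoc]
  congr 1
  exact_mod_cast card_filter_mem_notMem (mem_offDiag.mp hp).2.2

/-- Only pairs of distinct points occur on the right: apply the Schur test `sq_sum_sum_mul_mul_le`
across each cut `(A, Aᶜ)` and average over `A`. -/
theorem sq_sum_sum_le_sum_offDiag {k : ι → ι → ℝ} (hk : ∀ x y, 0 ≤ k x y) (hdiag : ∀ x, k x x = 0)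
    {ρ σ : ι → ℝ} (hρ : ∀ x, ∑ y, k x y ≤ ρ x) (hσ : ∀ y, ∑ x, k x y ≤ σ y) (f g : ι → ℝ) :
    (∑ x, ∑ y, k x y * (f x * g y)) ^ 2 ≤
      4 * ∑ p ∈ (univ : Finset ι).offDiag, ρ p.1 * f p.1 ^ 2 * (σ p.2 * g p.2 ^ 2) := by
  classical
  set cut : Finset ι → ℝ := fun A => ∑ x ∈ A, ∑ y ∈ Aᶜ, k x y * (f x * g y) with hcut
  set E := ∑ p ∈ (univ : Finset ι).offDiag, ρ p.1 * f p.1 ^ 2 * (σ p.2 * g p.2 ^ 2)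
  set n : ℝ := 2 ^ Fintype.card ι with hn
  have hnonneg : ∀ x, 0 ≤ ρ x := fun x => (sum_nonneg fun y _ => hk x y).trans (hρ x)
  have hsub : ∀ (A : Finset ι) (x : ι), ∑ y ∈ A, k x y ≤ ρ x := fun A x =>
    (sum_le_univ_sum_of_nonneg (hk x)).trans (hρ x)
  have hsub' : ∀ (A : Finset ι) (y : ι), ∑ x ∈ A, k x y ≤ σ y := fun A y =>
    (sum_le_univ_sum_of_nonneg fun x => hk x y).trans (hσ y)
  have hschur : ∀ A, cut A ^ 2 ≤ ∑ x ∈ A, ∑ y ∈ Aᶜ, ρ x * f x ^ 2 * (σ y * g y ^ 2) := by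
    intro A
    rw [← sum_mul_sum]
    refine (sq_sum_sum_mul_mul_le A Aᶜ (fun x _ y _ => hk x y) f g).trans ?_
    gcongr with x _ y _
    · exact sum_nonneg fun y _ =>
        mul_nonneg (sum_nonneg fun x _ => hk x y) (sq_nonneg _)
    · exact sum_nonneg fun x _ => mul_nonneg (hnonneg x) (sq_nonneg _)
    · exact hsub Aᶜ x
    · exact hsub' A y
  have hform : 4 * ∑ A, cut A = n * ∑ x, ∑ y, k x y * (f x * g y) := by
    rw [hcut, four_mul_sum_cut, ← sum_product', univ_product_univ,
      ← univ_product_univ, ← diag_union_offDiag,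
      sum_union (disjoint_diag_offDiag _), sum_diag]
    simp only [hdiag, zero_mul, sum_const_zero, zero_add]
    rfl
  have haverage : (∑ A, cut A) ^ 2 ≤ n * ∑ A, cut A ^ 2 := by
    simpa [hn, Fintype.card_finset] using sq_sum_le_card_mul_sum_sq (s := univ) (f := cut)
  have hsum : 4 * ∑ A, cut A ^ 2 ≤ n * E := by
    rw [← four_mul_sum_cut fun x y => ρ x * f x ^ 2 * (σ y * g y ^ 2)]
    gcongr with A
    exact hschur A
  refine le_of_mul_le_mul_left (a := n ^ 2) ?_ (pow_pos (pow_pos two_pos _) 2)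
  calc n ^ 2 * (∑ x, ∑ y, k x y * (f x * g y)) ^ 2 = 16 * (∑ A, cut A) ^ 2 := by
        rw [← mul_pow, ← hform]; ring
    _ ≤ 16 * (n * ∑ A, cut A ^ 2) := by gcongr
    _ = 4 * n * (4 * ∑ A, cut A ^ 2) := by ring
    _ ≤ 4 * n * (n * E) := by gcongr
    _ = n ^ 2 * (4 * E) := by ring

end Inequalities

section Monomials

theorem rpow_mul_rpow_mul_rpow_le {u v w α β γ : ℝ} (hu : 0 ≤ u) (hv : 0 ≤ v) (hw : 0 ≤ w)
    (hα : 0 ≤ α) (hβ : 0 ≤ β) (hγ : 0 ≤ γ) (h : α + β + γ ≤ 1) :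
    u ^ α * v ^ β * w ^ γ ≤ 1 + u + v + w := by
  have hamgm := Real.geom_mean_le_arith_mean4_weighted (sub_nonneg.mpr h) hα hβ hγ zero_le_one hu hv
    hw (by ring)
  rw [Real.one_rpow, one_mul, mul_one] at hamgm
  refine hamgm.trans ?_
  gcongr
  · linarith
  · exact mul_le_of_le_one_left hu (by linarith)
  · exact mul_le_of_le_one_left hv (by linarith)
  · exact mul_le_of_le_one_left hw (by linarith)

/-- Interpolation between the vertices `(0, 0, 0)`, `(1, 0, 0)`, `(2/3, 2/3, 0)` and
`(1/2, 1/2, 1/2)` of the region `2a + b + c ≤ 2`, `a ≥ b ≥ c ≥ 0`. -/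
theorem rpow_mul_rpow_mul_rpow_le_add_vertices {x y z a b c : ℝ} (hx : 0 ≤ x) (hy : 0 ≤ y)
    (hz : 0 ≤ z) (hc : 0 ≤ c) (hcb : c ≤ b) (hba : b ≤ a) (h : 2 * a + b + c ≤ 2) :
    x ^ a * y ^ b * z ^ c ≤
      1 + x + x ^ (2 / 3 : ℝ) * y ^ (2 / 3 : ℝ) + √x * √y * √z := by
  have hxa : x ^ a = x ^ (a - b) * (x ^ (2 / 3 : ℝ)) ^ (3 / 2 * (b - c)) * √x ^ (2 * c) := by
    rw [Real.sqrt_eq_rpow, ← Real.rpow_mul hx, ← Real.rpow_mul hx,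
      ← Real.rpow_add_of_nonneg hx (by linarith) (by linarith),
      ← Real.rpow_add_of_nonneg hx (by linarith) (by linarith)]
    congr 1
    ring
  have hyb : y ^ b = (y ^ (2 / 3 : ℝ)) ^ (3 / 2 * (b - c)) * √y ^ (2 * c) := by
    rw [Real.sqrt_eq_rpow, ← Real.rpow_mul hy, ← Real.rpow_mul hy,
      ← Real.rpow_add_of_nonneg hy (by linarith) (by linarith)]
    congr 1
    ring
  have hzc : z ^ c = √z ^ (2 * c) := by
    rw [Real.sqrt_eq_rpow, ← Real.rpow_mul hz]
    congr 1
    ring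
  calc x ^ a * y ^ b * z ^ c
      = x ^ (a - b) * (x ^ (2 / 3 : ℝ) * y ^ (2 / 3 : ℝ)) ^ (3 / 2 * (b - c)) *
          (√x * √y * √z) ^ (2 * c) := by
        rw [Real.mul_rpow (by positivity) (by positivity),
          Real.mul_rpow (by positivity) (by positivity),
          Real.mul_rpow (by positivity) (by positivity), hxa, hyb, hzc]
        ring
    _ ≤ _ := rpow_mul_rpow_mul_rpow_le hx (by positivity) (by positivity) (by linarith)
        (by linarith) (by linarith) (by linarith)

theorem rpow_mul_rpow_le_rpow_add_rpow {x y a b : ℝ} (hx : 0 ≤ x) (hy : 0 ≤ y) (ha : 0 ≤ a)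
    (hb : 0 ≤ b) : x ^ a * y ^ b ≤ x ^ (a + b) + y ^ (a + b) := by
  rw [Real.rpow_add_of_nonneg hx ha hb, Real.rpow_add_of_nonneg hy ha hb]
  rcases le_total x y with hxy | hyx
  · exact le_add_of_nonneg_of_le (by positivity) (by gcongr)
  · exact le_add_of_le_of_nonneg (by gcongr) (by positivity)

end Monomials

section Kernel

variable {V : Type*} [Fintype V]

/-- A weighted graph on `V`: a symmetric kernel with values in `[0, 1]` which vanishes on the
diagonal, has degrees at most `D`, and gives any two distinct points at most `K` common neighbours.
It abstracts what the proof uses of the relation `x - y ∈ S_t`. -/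
structure IsCodegreeKernel (w : V → V → ℝ) (D K : ℝ) : Prop where
  nonneg : ∀ x y, 0 ≤ w x y
  le_one : ∀ x y, w x y ≤ 1
  symm : ∀ x y, w x y = w y x
  irrefl : ∀ x, w x x = 0
  degree : ∀ x, ∑ y, w x y ≤ D
  codegree : ∀ x y, x ≠ y → ∑ z, w z x * w z y ≤ K

/-- The trilinear form counting weighted triangles. -/
def triangleSum (w : V → V → ℝ) (f g h : V → ℝ) : ℝ :=
  ∑ x, ∑ y, ∑ z, w x y * w y z * w z x * (f x * g y * h z)

/-- The unnormalized form `♦` of a kernel: a weighted count of 4-cycles `x₁x₂x₃x₄` with the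
diagonal `x₁x₃`. -/
def diamondSum (w : V → V → ℝ) (f₁ f₂ f₃ f₄ : V → ℝ) : ℝ :=
  ∑ x₁, ∑ x₂, ∑ x₃, ∑ x₄, w x₁ x₂ * w x₂ x₃ * w x₃ x₄ * w x₄ x₁ * w x₁ x₃ *
    (f₁ x₁ * f₂ x₂ * f₃ x₃ * f₄ x₄)

theorem triangleSum_rotate (w : V → V → ℝ) (f g h : V → ℝ) :
    triangleSum w f g h = triangleSum w g h f := by
  unfold triangleSum
  rw [sum_comm]
  refine sum_congr rfl fun y _ => ?_
  rw [sum_comm]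
  exact sum_congr rfl fun z _ => sum_congr rfl fun x _ => by ring

theorem diamondSum_mono {w : V → V → ℝ} (hw : ∀ x y, 0 ≤ w x y) {f₁ f₂ f₃ f₄ g₁ g₂ g₃ g₄ : V → ℝ}
    (hf₁ : ∀ x, 0 ≤ f₁ x) (hf₂ : ∀ x, 0 ≤ f₂ x) (hf₃ : ∀ x, 0 ≤ f₃ x) (hf₄ : ∀ x, 0 ≤ f₄ x)
    (h₁ : ∀ x, f₁ x ≤ g₁ x) (h₂ : ∀ x, f₂ x ≤ g₂ x) (h₃ : ∀ x, f₃ x ≤ g₃ x)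
    (h₄ : ∀ x, f₄ x ≤ g₄ x) : diamondSum w f₁ f₂ f₃ f₄ ≤ diamondSum w g₁ g₂ g₃ g₄ := by
  refine sum_le_sum fun x₁ _ => sum_le_sum fun x₂ _ => sum_le_sum fun x₃ _ =>
    sum_le_sum fun x₄ _ => mul_le_mul_of_nonneg_left ?_ ?_
  · have hg₁ := (hf₁ x₁).trans (h₁ x₁)
    have hg₂ := (hf₂ x₂).trans (h₂ x₂)
    have hg₃ := (hf₃ x₃).trans (h₃ x₃)
    exact mul_le_mul (mul_le_mul (mul_le_mul (h₁ x₁) (h₂ x₂) (hf₂ x₂) hg₁) (h₃ x₃) (hf₃ x₃)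
      (mul_nonneg hg₁ hg₂)) (h₄ x₄) (hf₄ x₄) (mul_nonneg (mul_nonneg hg₁ hg₂) hg₃)
  · exact mul_nonneg (mul_nonneg (mul_nonneg (mul_nonneg (hw _ _) (hw _ _)) (hw _ _)) (hw _ _))
      (hw _ _)

theorem diamondSum_const_mul (w : V → V → ℝ) (c₁ c₂ c₃ c₄ : ℝ) (f₁ f₂ f₃ f₄ : V → ℝ) :
    diamondSum w (fun x => c₁ * f₁ x) (fun x => c₂ * f₂ x) (fun x => c₃ * f₃ x)
      (fun x => c₄ * f₄ x) = c₁ * c₂ * c₃ * c₄ * diamondSum w f₁ f₂ f₃ f₄ := by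
  simp only [diamondSum, mul_sum]
  exact sum_congr rfl fun x₁ _ => sum_congr rfl fun x₂ _ => sum_congr rfl fun x₃ _ =>
    sum_congr rfl fun x₄ _ => by ring

theorem card_le_diamondSum {α : Type*} {w : V → V → ℝ} (hw : ∀ x y, 0 ≤ w x y)
    {f₁ f₂ f₃ f₄ : V → ℝ} (hf₁ : ∀ x, 0 ≤ f₁ x) (hf₂ : ∀ x, 0 ≤ f₂ x) (hf₃ : ∀ x, 0 ≤ f₃ x)
    (hf₄ : ∀ x, 0 ≤ f₄ x) {s : Finset α} {φ₁ φ₂ φ₃ φ₄ : α → V}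
    (hφ : Set.InjOn (fun a => (φ₁ a, φ₂ a, φ₃ a, φ₄ a)) s)
    (hone : ∀ a ∈ s, w (φ₁ a) (φ₂ a) * w (φ₂ a) (φ₃ a) * w (φ₃ a) (φ₄ a) * w (φ₄ a) (φ₁ a) *
      w (φ₁ a) (φ₃ a) * (f₁ (φ₁ a) * f₂ (φ₂ a) * f₃ (φ₃ a) * f₄ (φ₄ a)) = 1) :
    (#s : ℝ) ≤ diamondSum w f₁ f₂ f₃ f₄ := by
  classical
  set term : V × V × V × V → ℝ := fun x =>
    w x.1 x.2.1 * w x.2.1 x.2.2.1 * w x.2.2.1 x.2.2.2 * w x.2.2.2 x.1 * w x.1 x.2.2.1 *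
      (f₁ x.1 * f₂ x.2.1 * f₃ x.2.2.1 * f₄ x.2.2.2)
  have hterm : ∀ x, 0 ≤ term x := fun x => mul_nonneg
    (mul_nonneg (mul_nonneg (mul_nonneg (mul_nonneg (hw _ _) (hw _ _)) (hw _ _)) (hw _ _)) (hw _ _))
    (mul_nonneg (mul_nonneg (mul_nonneg (hf₁ _) (hf₂ _)) (hf₃ _)) (hf₄ _))
  calc (#s : ℝ) = ∑ a ∈ s, term (φ₁ a, φ₂ a, φ₃ a, φ₄ a) := by
        rw [sum_congr rfl hone, sum_const, nsmul_one]
    _ = ∑ x ∈ s.image fun a => (φ₁ a, φ₂ a, φ₃ a, φ₄ a), term x := (sum_image hφ).symm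
    _ ≤ ∑ x, term x := sum_le_univ_sum_of_nonneg hterm
    _ = diamondSum w f₁ f₂ f₃ f₄ := by simp only [Fintype.sum_prod_type, term, diamondSum]

namespace IsCodegreeKernel

variable {w : V → V → ℝ} {D K : ℝ} (hw : IsCodegreeKernel w D K)
include hw

theorem triangleSum_swap (f g h : V → ℝ) : triangleSum w f g h = triangleSum w g f h := by
  unfold triangleSum
  rw [sum_comm]
  refine sum_congr rfl fun y _ => sum_congr rfl fun x _ => sum_congr rfl fun z _ => ?_
  rw [hw.symm x y, hw.symm y z, hw.symm z x]
  ring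

theorem diamondSum_swap (f₁ f₂ f₃ f₄ : V → ℝ) :
    diamondSum w f₁ f₂ f₃ f₄ = diamondSum w f₁ f₄ f₃ f₂ := by
  unfold diamondSum
  refine sum_congr rfl fun x₁ _ => ?_
  conv_lhs => rw [sum_comm]
  conv_rhs => rw [sum_comm]
  refine sum_congr rfl fun x₃ _ => ?_
  rw [sum_comm]
  refine sum_congr rfl fun x₄ _ => sum_congr rfl fun x₂ _ => ?_
  rw [hw.symm x₁ x₂, hw.symm x₂ x₃, hw.symm x₃ x₄, hw.symm x₄ x₁]
  ring

theorem mul_codegree_le {x y : V} : w x y * ∑ z, w z x * w z y ≤ K * w x y := by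
  rcases eq_or_ne x y with rfl | hxy
  · simp only [hw.irrefl, zero_mul, mul_zero, le_refl]
  · rw [mul_comm]
    exact mul_le_mul_of_nonneg_right (hw.codegree x y hxy) (hw.nonneg x y)

theorem sum_sum_offDiag_le {φ : V × V → ℝ} (hφ : ∀ p, 0 ≤ φ p) :
    ∑ z, ∑ p ∈ univ.offDiag, w z p.1 * w z p.2 * φ p ≤ K * ∑ p ∈ univ.offDiag, φ p := by
  rw [sum_comm, mul_sum]
  refine sum_le_sum fun p hp => ?_
  rw [← sum_mul]
  exact mul_le_mul_of_nonneg_right (hw.codegree _ _ (mem_offDiag.mp hp).2.2) (hφ p)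

theorem sum_cube_sum_le (hD : 0 ≤ D) (hK : 1 ≤ K) {c : V → ℝ} (hc : ∀ x, 0 ≤ c x) :
    ∑ x, (∑ y, w x y * c y ^ 2) ^ 3 ≤ 4 * D * K * (∑ y, c y ^ 3) ^ 2 := by
  have hpair : ∀ p : V × V, 0 ≤ c p.1 ^ 3 * c p.2 ^ 3 := fun p =>
    mul_nonneg (pow_nonneg (hc _) 3) (pow_nonneg (hc _) 3)
  have hsingle : ∑ x, ∑ y, w x y * c y ^ 6 ≤ D * ∑ y, c y ^ 6 := by
    rw [sum_comm, mul_sum]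
    refine sum_le_sum fun y _ => ?_
    rw [← sum_mul, sum_congr rfl fun x _ => hw.symm x y]
    exact mul_le_mul_of_nonneg_right (hw.degree y) (pow_nonneg (hc y) 6)
  have hoff : ∑ x, ∑ p ∈ univ.offDiag, w x p.1 * c p.1 ^ 3 * (w x p.2 * c p.2 ^ 3) ≤
      K * ∑ p ∈ univ.offDiag, c p.1 ^ 3 * c p.2 ^ 3 := by
    simpa only [mul_mul_mul_comm] using hw.sum_sum_offDiag_le hpair
  calc ∑ x, (∑ y, w x y * c y ^ 2) ^ 3
      ≤ ∑ x, 4 * (∑ y, w x y * c y ^ 6 +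
          D * ∑ p ∈ univ.offDiag, w x p.1 * c p.1 ^ 3 * (w x p.2 * c p.2 ^ 3)) := by
        refine sum_le_sum fun x _ => (cube_sum_mul_sq_le univ (fun y _ => hw.nonneg x y)
          (fun y _ => hw.le_one x y) fun y _ => hc y).trans ?_
        gcongr
        · exact sum_nonneg fun p _ => mul_nonneg
            (mul_nonneg (hw.nonneg _ _) (pow_nonneg (hc _) 3))
            (mul_nonneg (hw.nonneg _ _) (pow_nonneg (hc _) 3))
        · exact hw.degree x
    _ ≤ 4 * (D * ∑ y, c y ^ 6 + D * (K * ∑ p ∈ univ.offDiag, c p.1 ^ 3 * c p.2 ^ 3)) := by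
        rw [← mul_sum, sum_add_distrib, ← mul_sum]
        gcongr
    _ ≤ 4 * (D * (K * ∑ y, c y ^ 6) + D * (K * ∑ p ∈ univ.offDiag, c p.1 ^ 3 * c p.2 ^ 3)) := by
        gcongr
        exact le_mul_of_one_le_left (sum_nonneg fun y _ => pow_nonneg (hc y) 6) hK
    _ = 4 * D * K * (∑ y, c y ^ 3) ^ 2 := by
        rw [sq_sum_eq_sum_sq_add_sum_offDiag]
        simp only [← pow_mul]
        ring

theorem cube_edge_sum_le (hD : 0 ≤ D) (hK : 1 ≤ K) {a c : V → ℝ} (ha : ∀ x, 0 ≤ a x)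
    (hc : ∀ x, 0 ≤ c x) :
    (∑ x, ∑ y, w x y * (a x ^ 2 * c y ^ 2)) ^ 3 ≤
      4 * D * K * (∑ x, a x ^ 3) ^ 2 * (∑ y, c y ^ 3) ^ 2 := by
  have hinner : ∀ x, 0 ≤ ∑ y, w x y * c y ^ 2 := fun x =>
    sum_nonneg fun y _ => mul_nonneg (hw.nonneg x y) (sq_nonneg _)
  calc (∑ x, ∑ y, w x y * (a x ^ 2 * c y ^ 2)) ^ 3
      = (∑ x, 1 * ((∑ y, w x y * c y ^ 2) * a x ^ 2)) ^ 3 := by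
        congr 1
        refine sum_congr rfl fun x _ => ?_
        rw [one_mul, sum_mul]
        exact sum_congr rfl fun y _ => by ring
    _ ≤ (∑ x, 1 * (∑ y, w x y * c y ^ 2) ^ 3) * (∑ x, 1 * a x ^ 3) ^ 2 :=
        cube_sum_mul_mul_sq_le univ (fun _ _ => zero_le_one) (fun x _ => hinner x) fun x _ => ha x
    _ ≤ 4 * D * K * (∑ y, c y ^ 3) ^ 2 * (∑ x, a x ^ 3) ^ 2 := by
        simp only [one_mul]
        gcongr
        exact hw.sum_cube_sum_le hD hK hc
    _ = _ := by ring

theorem sq_triangleSum_le (hK : 0 ≤ K) (f g h : V → ℝ) :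
    (triangleSum w f g h) ^ 2 ≤
      4 * K ^ 3 * ((∑ x, f x ^ 2) * (∑ y, g y ^ 2) * ∑ z, h z ^ 2) := by
  set link : V → V → V → ℝ := fun z x y => w z x * w z y * w x y
  set T : V → ℝ := fun z => ∑ x, ∑ y, link z x y * (f x * g y) with hT
  have hrow : ∀ z x, ∑ y, link z x y ≤ K * w z x := fun z x =>
    calc ∑ y, link z x y = w z x * ∑ y, w y z * w y x := by
          rw [mul_sum]
          refine sum_congr rfl fun y _ => ?_
          simp only [link, hw.symm y z, hw.symm y x, mul_assoc]
      _ ≤ K * w z x := hw.mul_codegree_le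
  have hcol : ∀ z y, ∑ x, link z x y ≤ K * w z y := fun z y =>
    (sum_congr rfl fun x _ => by simp only [link, hw.symm x y]; ring).trans_le (hrow z y)
  have hlink : ∀ z, T z ^ 2 ≤ 4 * K ^ 2 *
      ∑ p ∈ univ.offDiag, w z p.1 * w z p.2 * (f p.1 ^ 2 * g p.2 ^ 2) := fun z => by
    refine (sq_sum_sum_le_sum_offDiag
      (fun x y => mul_nonneg (mul_nonneg (hw.nonneg z x) (hw.nonneg z y)) (hw.nonneg x y))
      (fun x => by simp only [hw.irrefl, mul_zero]) (hrow z) (hcol z) f g).trans_eq ?_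
    rw [mul_assoc, mul_sum _ _ (K ^ 2)]
    exact congrArg _ (sum_congr rfl fun p _ => by ring)
  have hoff : ∑ p ∈ univ.offDiag, f p.1 ^ 2 * g p.2 ^ 2 ≤ (∑ x, f x ^ 2) * ∑ y, g y ^ 2 := by
    rw [sum_mul_sum, ← sum_product']
    exact sum_le_sum_of_subset_of_nonneg (subset_univ _) fun p _ _ =>
      mul_nonneg (sq_nonneg _) (sq_nonneg _)
  have hslice : triangleSum w f g h = ∑ z, T z * h z := by
    rw [triangleSum_rotate, triangleSum_rotate]
    refine sum_congr rfl fun z _ => ?_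
    simp only [hT, sum_mul]
    refine sum_congr rfl fun x _ => sum_congr rfl fun y _ => ?_
    simp only [link, hw.symm y z]
    ring
  calc (triangleSum w f g h) ^ 2 ≤ (∑ z, T z ^ 2) * ∑ z, h z ^ 2 :=
        hslice ▸ sum_mul_sq_le_sq_mul_sq univ T h
    _ ≤ (4 * K ^ 2 * (K * ((∑ x, f x ^ 2) * ∑ y, g y ^ 2))) * ∑ z, h z ^ 2 := by
        gcongr
        refine (sum_le_sum fun z _ => hlink z).trans ?_
        rw [← mul_sum]
        gcongr
        refine (hw.sum_sum_offDiag_le fun p => mul_nonneg (sq_nonneg _) (sq_nonneg _)).trans ?_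
        gcongr
    _ = _ := by ring

theorem triangleSum_one_right_le {f g : V → ℝ} (hf : ∀ x, 0 ≤ f x) (hg : ∀ x, 0 ≤ g x) :
    triangleSum w f g 1 ≤ K * ∑ x, ∑ y, w x y * (f x * g y) := by
  unfold triangleSum
  rw [mul_sum]
  refine sum_le_sum fun x _ => ?_
  rw [mul_sum]
  refine sum_le_sum fun y _ => ?_
  calc ∑ z, w x y * w y z * w z x * (f x * g y * (1 : V → ℝ) z)
      = (w x y * ∑ z, w z x * w z y) * (f x * g y) := by
        rw [mul_sum, sum_mul]
        refine sum_congr rfl fun z _ => ?_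
        rw [hw.symm y z, Pi.one_apply]
        ring
    _ ≤ K * w x y * (f x * g y) :=
        mul_le_mul_of_nonneg_right hw.mul_codegree_le (mul_nonneg (hf x) (hg y))
    _ = K * (w x y * (f x * g y)) := mul_assoc _ _ _

theorem triangleSum_one_one_le (hK : 0 ≤ K) {f : V → ℝ} (hf : ∀ x, 0 ≤ f x) :
    triangleSum w f 1 1 ≤ K * (D * ∑ x, f x) := by
  refine (hw.triangleSum_one_right_le hf fun _ => zero_le_one).trans ?_
  gcongr
  rw [mul_sum]
  refine sum_le_sum fun x _ => ?_
  rw [← sum_mul]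
  simpa only [Pi.one_apply, mul_one] using mul_le_mul_of_nonneg_right (hw.degree x) (hf x)

theorem diamondSum_one_right_le {f g h : V → ℝ} (hf : ∀ x, 0 ≤ f x) (hg : ∀ x, 0 ≤ g x)
    (hh : ∀ x, 0 ≤ h x) : diamondSum w f g h 1 ≤ K * triangleSum w f g h := by
  simp only [diamondSum, triangleSum, mul_sum]
  refine sum_le_sum fun x₁ _ => sum_le_sum fun x₂ _ => sum_le_sum fun x₃ _ => ?_
  calc ∑ x₄, w x₁ x₂ * w x₂ x₃ * w x₃ x₄ * w x₄ x₁ * w x₁ x₃ *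
        (f x₁ * g x₂ * h x₃ * (1 : V → ℝ) x₄)
      = w x₁ x₂ * w x₂ x₃ * (f x₁ * g x₂ * h x₃) * (w x₃ x₁ * ∑ x₄, w x₄ x₃ * w x₄ x₁) := by
        rw [mul_sum, mul_sum]
        refine sum_congr rfl fun x₄ _ => ?_
        rw [hw.symm x₃ x₄, hw.symm x₁ x₃, Pi.one_apply]
        ring
    _ ≤ w x₁ x₂ * w x₂ x₃ * (f x₁ * g x₂ * h x₃) * (K * w x₃ x₁) :=
        mul_le_mul_of_nonneg_left hw.mul_codegree_le (mul_nonneg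
          (mul_nonneg (hw.nonneg _ _) (hw.nonneg _ _))
          (mul_nonneg (mul_nonneg (hf _) (hg _)) (hh _)))
    _ = _ := by ring

section MeanOne

variable {F G H W : V → ℝ} (hD : 0 ≤ D) (hDV : (Fintype.card V : ℝ) ≤ D ^ 2) (hK : 1 ≤ K)
  (hF : ∀ x, 0 ≤ F x) (hG : ∀ x, 0 ≤ G x) (hH : ∀ x, 0 ≤ H x) (hW : ∀ x, 0 ≤ W x)
  (hF₁ : ∑ x, F x = Fintype.card V) (hG₁ : ∑ x, G x = Fintype.card V)
  (hH₁ : ∑ x, H x = Fintype.card V) (hW₁ : ∑ x, W x = Fintype.card V)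

include hD hDV hK hF hG hF₁ hG₁

theorem triangleSum_rpow_two_thirds_le :
    triangleSum w (fun x => F x ^ (2 / 3 : ℝ)) (fun x => G x ^ (2 / 3 : ℝ)) 1 ≤
      2 * K ^ 2 * (D * Fintype.card V) := by
  set N := (Fintype.card V : ℝ)
  have : 0 ≤ N := Nat.cast_nonneg _
  have hsq : ∀ {s : ℝ}, 0 ≤ s → (s ^ (1 / 3 : ℝ)) ^ 2 = s ^ (2 / 3 : ℝ) := fun hs => by
    rw [← Real.rpow_mul_natCast hs]; norm_num
  have hcube : ∀ {s : ℝ}, 0 ≤ s → (s ^ (1 / 3 : ℝ)) ^ 3 = s := fun hs => by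
    rw [← Real.rpow_mul_natCast hs]; norm_num
  have hedge : ∑ x, ∑ y, w x y * (F x ^ (2 / 3 : ℝ) * G y ^ (2 / 3 : ℝ)) ≤ 2 * K * D * N := by
    have hcubic := hw.cube_edge_sum_le hD hK (fun x => Real.rpow_nonneg (hF x) (1 / 3))
      fun x => Real.rpow_nonneg (hG x) (1 / 3)
    simp only [hsq (hF _), hsq (hG _), hcube (hF _), hcube (hG _), hF₁, hG₁] at hcubic
    refine le_of_pow_le_pow_left₀ three_ne_zero (by positivity) (hcubic.trans ?_)
    calc 4 * D * K * N ^ 2 * N ^ 2 = 4 * D * K * N ^ 3 * N := by ring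
      _ ≤ 4 * D * K * N ^ 3 * D ^ 2 := by gcongr
      _ = 4 * D ^ 3 * N ^ 3 * K := by ring
      _ ≤ 8 * D ^ 3 * N ^ 3 * K ^ 3 := by
        gcongr
        · norm_num
        · exact le_self_pow₀ hK three_ne_zero
      _ = (2 * K * D * N) ^ 3 := by ring
  calc _ ≤ K * ∑ x, ∑ y, w x y * (F x ^ (2 / 3 : ℝ) * G y ^ (2 / 3 : ℝ)) :=
        hw.triangleSum_one_right_le (fun x => Real.rpow_nonneg (hF x) _)
          fun x => Real.rpow_nonneg (hG x) _
    _ ≤ K * (2 * K * D * N) := by gcongr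
    _ = 2 * K ^ 2 * (D * N) := by ring

include hH hH₁

theorem triangleSum_sqrt_le :
    triangleSum w (fun x => √(F x)) (fun x => √(G x)) (fun x => √(H x)) ≤
      2 * K ^ 2 * (D * Fintype.card V) := by
  set N := (Fintype.card V : ℝ)
  have : 0 ≤ N := Nat.cast_nonneg _
  have hsquare := hw.sq_triangleSum_le (zero_le_one.trans hK) (fun x => √(F x)) (fun x => √(G x))
    fun x => √(H x)
  simp only [Real.sq_sqrt (hF _), Real.sq_sqrt (hG _), Real.sq_sqrt (hH _), hF₁, hG₁, hH₁]
    at hsquare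
  refine le_of_pow_le_pow_left₀ two_ne_zero (by positivity) (hsquare.trans ?_)
  calc 4 * K ^ 3 * (N * N * N) = 4 * K ^ 3 * N ^ 2 * N := by ring
    _ ≤ 4 * K ^ 4 * N ^ 2 * D ^ 2 := by
      gcongr
      norm_num
    _ = (2 * K ^ 2 * (D * N)) ^ 2 := by ring

theorem triangleSum_rpow_le_of_antitone {a b c : ℝ} (hc : 0 ≤ c) (hcb : c ≤ b) (hba : b ≤ a)
    (h : 2 * a + b + c ≤ 2) :
    triangleSum w (fun x => F x ^ a) (fun x => G x ^ b) (fun x => H x ^ c) ≤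
      6 * K ^ 2 * (D * Fintype.card V) := by
  have hK₀ : 0 ≤ K := zero_le_one.trans hK
  have hsplit : triangleSum w (fun x => F x ^ a) (fun x => G x ^ b) (fun x => H x ^ c) ≤
      triangleSum w 1 1 1 + triangleSum w F 1 1 +
        triangleSum w (fun x => F x ^ (2 / 3 : ℝ)) (fun x => G x ^ (2 / 3 : ℝ)) 1 +
        triangleSum w (fun x => √(F x)) (fun x => √(G x)) (fun x => √(H x)) := by
    simp only [triangleSum, ← sum_add_distrib, Pi.one_apply, mul_one]
    refine sum_le_sum fun x _ => sum_le_sum fun y _ => sum_le_sum fun z _ => ?_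
    simp only [← mul_one_add, ← mul_add]
    exact mul_le_mul_of_nonneg_left
      (rpow_mul_rpow_mul_rpow_le_add_vertices (hF x) (hG y) (hH z) hc hcb hba h)
      (mul_nonneg (mul_nonneg (hw.nonneg x y) (hw.nonneg y z)) (hw.nonneg z x))
  have hcount : triangleSum w 1 1 1 ≤ K * (D * Fintype.card V) := by
    simpa only [Pi.one_apply, sum_const, card_univ, nsmul_eq_mul, mul_one] using
      hw.triangleSum_one_one_le hK₀ (f := 1) fun _ => zero_le_one
  have hvertex : triangleSum w F 1 1 ≤ K * (D * Fintype.card V) :=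
    hF₁ ▸ hw.triangleSum_one_one_le hK₀ hF
  have hedge := hw.triangleSum_rpow_two_thirds_le hD hDV hK hF hG hF₁ hG₁
  have htriangle := hw.triangleSum_sqrt_le hD hDV hK hF hG hH hF₁ hG₁ hH₁
  have hKK : K * (D * Fintype.card V) ≤ K ^ 2 * (D * Fintype.card V) := by
    gcongr
    exact le_self_pow₀ hK two_ne_zero
  linarith

theorem triangleSum_rpow_le {a b c : ℝ} (ha : 0 ≤ a) (hb : 0 ≤ b) (hc : 0 ≤ c)
    (h₁ : 2 * a + b + c ≤ 2) (h₂ : a + 2 * b + c ≤ 2) (h₃ : a + b + 2 * c ≤ 2) :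
    triangleSum w (fun x => F x ^ a) (fun x => G x ^ b) (fun x => H x ^ c) ≤
      6 * K ^ 2 * (D * Fintype.card V) := by
  wlog hba : b ≤ a generalizing a b F G
  · rw [hw.triangleSum_swap]
    exact this hG hF hG₁ hF₁ hb ha (by linarith) (by linarith) (by linarith) (le_of_not_ge hba)
  rcases le_total c b with hcb | hbc
  · exact hw.triangleSum_rpow_le_of_antitone hD hDV hK hF hG hH hF₁ hG₁ hH₁ hc hcb hba h₁
  rcases le_total c a with hca | hac
  · rw [hw.triangleSum_swap, triangleSum_rotate]
    exact hw.triangleSum_rpow_le_of_antitone hD hDV hK hF hH hG hF₁ hH₁ hG₁ hb hbc hca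
      (by linarith)
  · rw [← triangleSum_rotate]
    exact hw.triangleSum_rpow_le_of_antitone hD hDV hK hH hF hG hH₁ hF₁ hG₁ hb hba hac
      (by linarith)

include hW hW₁

theorem diamondSum_rpow_le {a₁ a₂ a₃ a₄ : ℝ} (ha₁ : 0 ≤ a₁) (ha₂ : 0 ≤ a₂) (ha₃ : 0 ≤ a₃)
    (ha₄ : 0 ≤ a₄) (h₁ : a₁ + a₂ + 2 * a₃ + a₄ ≤ 2) (h₂ : 2 * a₁ + a₂ + a₃ + a₄ ≤ 2)
    (h₃ : a₁ + 2 * a₂ + a₃ + 2 * a₄ ≤ 2) :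
    diamondSum w (fun x => F x ^ a₁) (fun x => G x ^ a₂) (fun x => H x ^ a₃) (fun x => W x ^ a₄) ≤
      12 * K ^ 3 * (D * Fintype.card V) := by
  have hsplit : diamondSum w (fun x => F x ^ a₁) (fun x => G x ^ a₂) (fun x => H x ^ a₃)
      (fun x => W x ^ a₄) ≤
        diamondSum w (fun x => F x ^ a₁) (fun x => G x ^ (a₂ + a₄)) (fun x => H x ^ a₃) 1 +
        diamondSum w (fun x => F x ^ a₁) 1 (fun x => H x ^ a₃) (fun x => W x ^ (a₂ + a₄)) := by
    simp only [diamondSum, ← sum_add_distrib, Pi.one_apply, mul_one]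
    refine sum_le_sum fun x₁ _ => sum_le_sum fun x₂ _ => sum_le_sum fun x₃ _ =>
      sum_le_sum fun x₄ _ => ?_
    have hweight := hw.nonneg
    rw [← mul_add]
    refine mul_le_mul_of_nonneg_left ?_ (mul_nonneg (mul_nonneg (mul_nonneg (mul_nonneg
      (hweight x₁ x₂) (hweight x₂ x₃)) (hweight x₃ x₄)) (hweight x₄ x₁)) (hweight x₁ x₃))
    calc F x₁ ^ a₁ * G x₂ ^ a₂ * H x₃ ^ a₃ * W x₄ ^ a₄
        = F x₁ ^ a₁ * H x₃ ^ a₃ * (G x₂ ^ a₂ * W x₄ ^ a₄) := by ring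
      _ ≤ F x₁ ^ a₁ * H x₃ ^ a₃ * (G x₂ ^ (a₂ + a₄) + W x₄ ^ (a₂ + a₄)) :=
        mul_le_mul_of_nonneg_left (rpow_mul_rpow_le_rpow_add_rpow (hG x₂) (hW x₄) ha₂ ha₄)
          (mul_nonneg (Real.rpow_nonneg (hF x₁) _) (Real.rpow_nonneg (hH x₃) _))
      _ = _ := by ring
  have hhalf : ∀ {Y : V → ℝ}, (∀ x, 0 ≤ Y x) → ∑ x, Y x = Fintype.card V →
      diamondSum w (fun x => F x ^ a₁) (fun x => Y x ^ (a₂ + a₄)) (fun x => H x ^ a₃) 1 ≤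
        K * (6 * K ^ 2 * (D * Fintype.card V)) := fun hY hY₁ => by
    refine (hw.diamondSum_one_right_le (fun x => Real.rpow_nonneg (hF x) _)
      (fun x => Real.rpow_nonneg (hY x) _) fun x => Real.rpow_nonneg (hH x) _).trans ?_
    gcongr
    exact hw.triangleSum_rpow_le hD hDV hK hF hY hH hF₁ hY₁ hH₁ ha₁ (add_nonneg ha₂ ha₄) ha₃
      (by linarith) (by linarith) (by linarith)
  have hright := hhalf hG hG₁
  have hleft := hhalf hW hW₁
  rw [hw.diamondSum_swap] at hleft
  linarith

end MeanOne

end IsCodegreeKernel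

end Kernel

section Geometry

variable {F : Type} [Field F]

/-- The determinant of two vectors in the plane; together with the scalar product it plays the role
of complex multiplication. -/
def wedge (u v : Fin 2 → F) : F := u 0 * v 1 - u 1 * v 0

theorem quadNorm_eq (x : Fin 2 → F) : quadNorm x = x 0 ^ 2 + x 1 ^ 2 := Fin.sum_univ_two _

theorem quadNorm_vec (a b : F) : quadNorm ![a, b] = a ^ 2 + b ^ 2 := quadNorm_eq _

theorem quadNorm_smul {R : Type*} [CommSemiring R] [Algebra R F] (c : R) (x : Fin 2 → F) :
    quadNorm (c • x) = c ^ 2 • quadNorm x := by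
  simp only [quadNorm_eq, Pi.smul_apply, smul_pow, smul_add]

theorem quadNorm_sub (u v : Fin 2 → F) :
    quadNorm (u - v) = quadNorm u + quadNorm v - 2 * (u ⬝ᵥ v) := by
  simp only [quadNorm_eq, Pi.sub_apply, dotProduct, Fin.sum_univ_two]
  ring

theorem quadNorm_sub_comm (u v : Fin 2 → F) : quadNorm (u - v) = quadNorm (v - u) := by
  rw [quadNorm_sub, quadNorm_sub, dotProduct_comm]
  ring

theorem dotProduct_sq_add_wedge_sq (u v : Fin 2 → F) :
    (u ⬝ᵥ v) ^ 2 + wedge u v ^ 2 = quadNorm u * quadNorm v := by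
  simp only [quadNorm_eq, wedge, dotProduct, Fin.sum_univ_two]
  ring

theorem eq_of_dotProduct_eq_of_wedge_eq {u v v' : Fin 2 → F} (hu : quadNorm u ≠ 0)
    (hdot : u ⬝ᵥ v = u ⬝ᵥ v') (hwedge : wedge u v = wedge u v') : v = v' := by
  simp only [wedge, dotProduct, Fin.sum_univ_two, quadNorm_eq] at hu hdot hwedge
  ext i
  refine mul_left_cancel₀ hu ?_
  fin_cases i
  · change _ * v 0 = _ * v' 0
    linear_combination u 0 * hdot - u 1 * hwedge
  · change _ * v 1 = _ * v' 1
    linear_combination u 1 * hdot + u 0 * hwedge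

theorem mem_circle {t : F} {x : Fin 2 → F} : x ∈ circle t ↔ quadNorm x = t := Iff.rfl

theorem circleInd_of_eq {t : F} {x : Fin 2 → F} (h : quadNorm x = t) : circleInd t x = 1 :=
  Set.indicator_of_mem (mem_circle.mpr h) 1

theorem circleInd_of_ne {t : F} {x : Fin 2 → F} (h : quadNorm x ≠ t) : circleInd t x = 0 :=
  Set.indicator_of_notMem (mem_circle.not.mpr h) 1

theorem circleInd_eq_ite [DecidableEq F] (t : F) (x : Fin 2 → F) :
    circleInd t x = if quadNorm x = t then 1 else 0 := by
  split_ifs with h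
  · exact circleInd_of_eq h
  · exact circleInd_of_ne h

theorem circleInd_nonneg (t : F) (x : Fin 2 → F) : 0 ≤ circleInd t x :=
  Set.indicator_nonneg (fun _ _ => zero_le_one) x

theorem circleInd_le_one (t : F) (x : Fin 2 → F) : circleInd t x ≤ 1 :=
  Set.indicator_le_self' (fun _ _ => zero_le_one) x

theorem circleInd_sub_comm (t : F) (x y : Fin 2 → F) :
    circleInd t (x - y) = circleInd t (y - x) := by
  classical
  simp only [circleInd_eq_ite, quadNorm_sub_comm x y]

theorem card_le_of_pow_eq {α R : Type*} [CommRing R] [IsDomain R] {s : Finset α} {f : α → R} {n : ℕ}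
    {c : R} (hn : 0 < n) (hinj : Set.InjOn f s) (hf : ∀ x ∈ s, f x ^ n = c) : #s ≤ n := by
  classical
  calc #s = #(s.image f) := (card_image_of_injOn hinj).symm
    _ ≤ #(Polynomial.nthRoots n c).toFinset := card_le_card fun y hy => by
      obtain ⟨x, hx, rfl⟩ := mem_image.mp hy
      exact Multiset.mem_toFinset.mpr ((Polynomial.mem_nthRoots hn).mpr (hf x hx))
    _ ≤ n := (Multiset.toFinset_card_le _).trans (Polynomial.card_nthRoots n c)

theorem circle_nonempty [Finite F] (h2 : (2 : F) ≠ 0) (t : F) : (circle t).Nonempty := by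
  have := Fintype.ofFinite F
  have hodd : Fintype.card F % 2 = 1 :=
    FiniteField.odd_card_of_char_ne_two fun h => h2 <| by
      have : CharP F 2 := ringChar.of_eq h
      exact CharTwo.two_eq_zero
  obtain ⟨a, b, hab⟩ := FiniteField.exists_root_sum_quadratic
    (Polynomial.degree_X_pow (R := F) 2) (Polynomial.degree_X_pow_sub_C two_pos t) hodd
  refine ⟨![a, b], ?_⟩
  simp only [Polynomial.eval_pow, Polynomial.eval_X, Polynomial.eval_sub, Polynomial.eval_C] at hab
  rw [mem_circle, quadNorm_vec]
  linear_combination hab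

/-- Multiplication by a point of `S_t` maps `S_1` into `S_t`. -/
theorem ncard_circle_one_le [Finite F] {t : F} (ht : t ≠ 0) (hne : (circle t).Nonempty) :
    (circle (1 : F)).ncard ≤ (circle t).ncard := by
  obtain ⟨p, hp⟩ := hne
  refine Set.ncard_le_ncard_of_injOn (fun v => ![p ⬝ᵥ v, wedge p v]) (fun v hv => ?_)
    fun v _ v' _ h => ?_
  · rw [mem_circle, quadNorm_vec, dotProduct_sq_add_wedge_sq, mem_circle.mp hp,
      mem_circle.mp hv, mul_one]
  · exact eq_of_dotProduct_eq_of_wedge_eq ((mem_circle.mp hp).trans_ne ht) (congrFun h 0)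
      (congrFun h 1)

variable [Fintype F]

theorem sum_circleInd (t : F) : ∑ v, circleInd t v = ((circle t).ncard : ℝ) := by
  classical
  rw [Set.ncard_eq_toFinset_card']
  simp [circleInd, Set.indicator_apply]

theorem ncard_circle_le (t : F) : (circle t).ncard ≤ 2 * Fintype.card F := by
  classical
  have hfibre : ∀ b ∈ (univ : Finset F), #{v ∈ (circle t).toFinset | v 0 = b} ≤ 2 := fun b _ => by
    refine card_le_of_pow_eq (f := fun v => v 1) (c := t - b ^ 2) two_pos ?_ fun v hv => ?_
    · intro v hv v' hv' h
      ext i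
      fin_cases i
      · exact (mem_filter.mp hv).2.trans (mem_filter.mp hv').2.symm
      · exact h
    · obtain ⟨hvt, rfl⟩ := mem_filter.mp hv
      rw [← mem_circle.mp (Set.mem_toFinset.mp hvt), quadNorm_eq]
      ring
  rw [Set.ncard_eq_toFinset_card']
  exact card_le_mul_card_image_of_maps_to (fun _ _ => mem_univ _) 2 hfibre

theorem card_inter_circles_le {t : F} [DecidableEq F] (ht : t ≠ 0) (h2 : (2 : F) ≠ 0)
    {x y : Fin 2 → F} (hxy : x ≠ y) :
    #{z : Fin 2 → F | quadNorm (z - x) = t ∧ quadNorm (z - y) = t} ≤ 2 := by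
  set u := y - x with hu
  have hdot : ∀ z, quadNorm (z - x) = t → quadNorm (z - y) = t →
      2 * (u ⬝ᵥ (z - x)) = quadNorm u := fun z hzx hzy => by
    have hexpand := quadNorm_sub (z - x) u
    rw [hu, sub_sub_sub_cancel_right, hzx, hzy, dotProduct_comm] at hexpand
    linear_combination hexpand
  -- An isotropic `u` would be both orthogonal and parallel to `z - x`, whose norm is not zero.
  have hu0 : ∀ z, quadNorm (z - x) = t → quadNorm (z - y) = t → quadNorm u ≠ 0 :=
    fun z hzx hzy hu0 => by
      have hdot0 : u ⬝ᵥ (z - x) = 0 := by simpa [hu0, h2] using hdot z hzx hzy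
      rw [dotProduct_comm] at hdot0
      have hwedge0 : wedge (z - x) u = 0 := by
        simpa [hu0, hdot0] using dotProduct_sq_add_wedge_sq (z - x) u
      have hux : u = 0 := eq_of_dotProduct_eq_of_wedge_eq (hzx.trans_ne ht)
        (hdot0.trans (dotProduct_zero _).symm) (hwedge0.trans (by simp [wedge]))
      exact hxy (sub_eq_zero.mp hux).symm
  refine card_le_of_pow_eq (f := fun z => 2 * wedge u (z - x))
    (c := 4 * quadNorm u * t - quadNorm u ^ 2) two_pos ?_ fun z hz => ?_
  · intro z hz z' hz' h
    obtain ⟨-, hzx, hzy⟩ := mem_filter.mp hz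
    obtain ⟨-, hzx', hzy'⟩ := mem_filter.mp hz'
    refine sub_left_injective (b := x) (eq_of_dotProduct_eq_of_wedge_eq (hu0 z hzx hzy) ?_ ?_)
    · exact mul_left_cancel₀ h2 ((hdot z hzx hzy).trans (hdot z' hzx' hzy').symm)
    · exact mul_left_cancel₀ h2 h
  · obtain ⟨-, hzx, hzy⟩ := mem_filter.mp hz
    have hlagrange := dotProduct_sq_add_wedge_sq u (z - x)
    rw [hzx] at hlagrange
    linear_combination 4 * hlagrange - (2 * (u ⬝ᵥ (z - x)) + quadNorm u) * hdot z hzx hzy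

theorem isCodegreeKernel_circleInd {t : F} (ht : t ≠ 0) (h2 : (2 : F) ≠ 0) :
    IsCodegreeKernel (fun x y : Fin 2 → F => circleInd t (x - y)) (2 * Fintype.card F) 2 where
  nonneg _ _ := circleInd_nonneg _ _
  le_one _ _ := circleInd_le_one _ _
  symm := circleInd_sub_comm t
  irrefl x := circleInd_of_ne (by simpa [quadNorm_eq] using ht.symm)
  degree x := by
    refine ((Equiv.subLeft x).sum_comp (circleInd t)).trans_le ?_
    rw [sum_circleInd]
    exact_mod_cast ncard_circle_le t
  codegree x y hxy := by
    classical
    have hcount : ∑ z, circleInd t (z - x) * circleInd t (z - y) =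
        #{z : Fin 2 → F | quadNorm (z - x) = t ∧ quadNorm (z - y) = t} := by
      simp only [circleInd_eq_ite, ← sum_boole, ite_and, ite_mul, one_mul, zero_mul]
    rw [hcount]
    exact_mod_cast card_inter_circles_le ht h2 hxy

/-- Stereographic projection: all but at most two parameters `m` give a point
`((1 - m²) / (1 + m²), 2m / (1 + m²))` of the unit circle. -/
theorem card_le_ncard_circle_one_add_two (h2 : (2 : F) ≠ 0) :
    Fintype.card F ≤ (circle (1 : F)).ncard + 2 := by
  classical
  have hbad : #{m : F | 1 + m ^ 2 = 0} ≤ 2 :=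
    card_le_of_pow_eq (f := id) (c := -1) two_pos Function.injective_id.injOn fun m hm => by
      rw [id]
      linear_combination (mem_filter.mp hm).2
  have hgood : #{m : F | ¬ 1 + m ^ 2 = 0} ≤ (circle (1 : F)).ncard := by
    rw [← Set.ncard_coe_finset]
    refine Set.ncard_le_ncard_of_injOn
      (fun m => ![(1 - m ^ 2) / (1 + m ^ 2), 2 * m / (1 + m ^ 2)]) (fun m hm => ?_)
      fun m hm m' hm' h => ?_
    · have hm : 1 + m ^ 2 ≠ 0 := (mem_filter.mp hm).2
      rw [mem_circle, quadNorm_vec]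
      field_simp
      ring
    · have hm : 1 + m ^ 2 ≠ 0 := (mem_filter.mp hm).2
      have hm' : 1 + m' ^ 2 ≠ 0 := (mem_filter.mp hm').2
      have hcos : (1 - m ^ 2) / (1 + m ^ 2) = (1 - m' ^ 2) / (1 + m' ^ 2) := congrFun h 0
      have hsin : 2 * m / (1 + m ^ 2) = 2 * m' / (1 + m' ^ 2) := congrFun h 1
      rw [div_eq_div_iff hm hm'] at hcos hsin
      refine mul_left_cancel₀ (mul_ne_zero h2 hm) ?_
      linear_combination hsin - m * hcos
  rw [← card_univ, ← card_filter_add_card_filter_not (fun m : F => 1 + m ^ 2 = 0)]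
  omega

theorem card_le_three_mul_ncard_circle {t : F} (ht : t ≠ 0) (h2 : (2 : F) ≠ 0) :
    Fintype.card F ≤ 3 * (circle t).ncard := by
  have hne := circle_nonempty h2 t
  have hpos : 0 < (circle t).ncard := (Set.ncard_pos).mpr hne
  have hle := ncard_circle_one_le ht hne
  have hcard := card_le_ncard_circle_one_add_two h2
  omega

end Geometry

section UpperBound

variable {F : Type} [Field F] [Fintype F]

theorem diamond_eq (t : F) (f₁ f₂ f₃ f₄ : (Fin 2 → F) → ℝ) :
    diamond t f₁ f₂ f₃ f₄ = ((Fintype.card F : ℝ) ^ 2 * (circle t).ncard)⁻¹ *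
      diamondSum (fun x y => circleInd t (x - y)) f₁ f₂ f₃ f₄ := rfl

/-- In characteristic two the form `‖·‖` is additive, so `S_t` contains no triangle. -/
theorem diamond_eq_zero_of_two_eq_zero {t : F} (ht : t ≠ 0) (h2 : (2 : F) = 0)
    (f₁ f₂ f₃ f₄ : (Fin 2 → F) → ℝ) : diamond t f₁ f₂ f₃ f₄ = 0 := by
  refine mul_eq_zero_of_right _ (sum_eq_zero fun x₁ _ => sum_eq_zero fun x₂ _ =>
    sum_eq_zero fun x₃ _ => sum_eq_zero fun x₄ _ => ?_)
  by_cases h₁₂ : quadNorm (x₁ - x₂) = t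
  swap; · simp only [circleInd_of_ne h₁₂, zero_mul]
  by_cases h₂₃ : quadNorm (x₂ - x₃) = t
  swap; · simp only [circleInd_of_ne h₂₃, mul_zero, zero_mul]
  have h₁₃ : quadNorm (x₁ - x₃) ≠ t := fun h₁₃ => ht <| by
    have hadd := quadNorm_sub (x₁ - x₂) (x₃ - x₂)
    rw [sub_sub_sub_cancel_right, quadNorm_sub_comm x₃ x₂, h₁₂, h₂₃, h₁₃, h2, zero_mul] at hadd
    linear_combination -hadd
  simp only [circleInd_of_ne h₁₃, mul_zero, zero_mul]

theorem diamond_rpow_le {t : F} (ht : t ≠ 0) {g₁ g₂ g₃ g₄ : (Fin 2 → F) → ℝ}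
    (hg₁ : ∀ x, 0 ≤ g₁ x) (hg₂ : ∀ x, 0 ≤ g₂ x) (hg₃ : ∀ x, 0 ≤ g₃ x) (hg₄ : ∀ x, 0 ≤ g₄ x)
    (hmean₁ : ∑ x, g₁ x = Fintype.card (Fin 2 → F)) (hmean₂ : ∑ x, g₂ x = Fintype.card (Fin 2 → F))
    (hmean₃ : ∑ x, g₃ x = Fintype.card (Fin 2 → F)) (hmean₄ : ∑ x, g₄ x = Fintype.card (Fin 2 → F))
    {a₁ a₂ a₃ a₄ : ℝ} (ha₁ : 0 ≤ a₁) (ha₂ : 0 ≤ a₂) (ha₃ : 0 ≤ a₃) (ha₄ : 0 ≤ a₄)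
    (h₁ : a₁ + a₂ + 2 * a₃ + a₄ ≤ 2) (h₂ : 2 * a₁ + a₂ + a₃ + a₄ ≤ 2)
    (h₃ : a₁ + 2 * a₂ + a₃ + 2 * a₄ ≤ 2) :
    diamond t (fun x => g₁ x ^ a₁) (fun x => g₂ x ^ a₂) (fun x => g₃ x ^ a₃)
      (fun x => g₄ x ^ a₄) ≤ 576 := by
  by_cases h2 : (2 : F) = 0
  · rw [diamond_eq_zero_of_two_eq_zero ht h2]
    norm_num
  have hqN : (Fintype.card F : ℝ) ≤ 3 * (circle t).ncard := by
    exact_mod_cast card_le_three_mul_ncard_circle ht h2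
  set q := (Fintype.card F : ℝ)
  set N := ((circle t).ncard : ℝ)
  have hq : 0 < q := Nat.cast_pos.mpr Fintype.card_pos
  have hN : 0 < N := by linarith
  have hcard : (Fintype.card (Fin 2 → F) : ℝ) = q ^ 2 := by simp [q]
  have hsum := (isCodegreeKernel_circleInd ht h2).diamondSum_rpow_le (by positivity)
    (by rw [hcard]; gcongr; linarith) one_le_two hg₁ hg₂ hg₃ hg₄ hmean₁ hmean₂ hmean₃ hmean₄
    ha₁ ha₂ ha₃ ha₄ h₁ h₂ h₃
  rw [diamond_eq, inv_mul_le_iff₀ (by positivity)]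
  calc _ ≤ 12 * 2 ^ 3 * (2 * q * q ^ 2) := hcard ▸ hsum
    _ ≤ 12 * 2 ^ 3 * (2 * (3 * N) * q ^ 2) := by gcongr
    _ = q ^ 2 * N * 576 := by ring

theorem lpNorm_nonneg (p : ℝ≥0∞) (f : (Fin 2 → F) → ℝ) : 0 ≤ lpNorm p f := by
  unfold lpNorm
  split_ifs
  · exact Real.iSup_nonneg fun _ => abs_nonneg _
  · exact Real.rpow_nonneg (mul_nonneg (by positivity)
      (sum_nonneg fun _ _ => Real.rpow_nonneg (abs_nonneg _) _)) _

theorem lpNorm_of_ne_top {p : ℝ≥0∞} (hp : p ≠ ∞) {f : (Fin 2 → F) → ℝ} (hf : ∀ x, 0 ≤ f x) :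
    lpNorm p f =
      (((Fintype.card F : ℝ) ^ 2)⁻¹ * ∑ x, f x ^ p.toReal) ^ (p⁻¹).toReal := by
  simp only [lpNorm, if_neg hp, abs_of_nonneg (hf _), one_div, ENNReal.toReal_inv]

theorem exists_le_lpNorm_mul_rpow {p : ℝ≥0∞} (hp : 0 < p) {f : (Fin 2 → F) → ℝ}
    (hf : ∀ x, 0 ≤ f x) : ∃ g : (Fin 2 → F) → ℝ, (∀ x, 0 ≤ g x) ∧
      ∑ x, g x = Fintype.card (Fin 2 → F) ∧ ∀ x, f x ≤ lpNorm p f * g x ^ (p⁻¹).toReal := by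
  by_cases htop : p = ∞
  · refine ⟨1, fun _ => zero_le_one, by simp, fun x => ?_⟩
    simp only [htop, lpNorm, if_true, Pi.one_apply, Real.one_rpow, mul_one]
    exact (le_abs_self _).trans (le_ciSup (f := fun x => |f x|) (Set.finite_range _).bddAbove x)
  have hP : 0 < p.toReal := ENNReal.toReal_pos hp.ne' htop
  have hpow : ∀ x, 0 ≤ f x ^ p.toReal := fun x => Real.rpow_nonneg (hf x) _
  set S := ∑ x, f x ^ p.toReal with hS
  have hS₀ : 0 ≤ S := sum_nonneg fun x _ => hpow x
  rcases hS₀.eq_or_lt with hzero | hpos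
  · refine ⟨1, fun _ => zero_le_one, by simp, fun x => ?_⟩
    have hx := (sum_eq_zero_iff_of_nonneg fun x _ => hpow x).mp hzero.symm x (mem_univ x)
    rw [(Real.rpow_eq_zero (hf x) hP.ne').mp hx]
    exact mul_nonneg (lpNorm_nonneg p f) (Real.rpow_nonneg zero_le_one _)
  · have hg : ∀ x, 0 ≤ f x ^ p.toReal * ((Fintype.card F : ℝ) ^ 2 / S) := fun x =>
      mul_nonneg (hpow x) (by positivity)
    refine ⟨fun x => f x ^ p.toReal * ((Fintype.card F : ℝ) ^ 2 / S), hg, ?_, fun x => le_of_eq ?_⟩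
    · rw [← sum_mul, ← hS, mul_div_cancel₀ _ hpos.ne']
      simp
    · have hcancel : ((Fintype.card F : ℝ) ^ 2)⁻¹ * S *
          (f x ^ p.toReal * ((Fintype.card F : ℝ) ^ 2 / S)) = f x ^ p.toReal := by
        field_simp
      rw [lpNorm_of_ne_top htop hf, ← hS, ← Real.mul_rpow (by positivity) (hg x), hcancel,
        ENNReal.toReal_inv, Real.rpow_rpow_inv (hf x) hP.ne']

theorem necessaryConditions_iff {p₁ p₂ p₃ p₄ : ℝ≥0∞} (hp₁ : 0 < p₁) (hp₂ : 0 < p₂) (hp₃ : 0 < p₃)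
    (hp₄ : 0 < p₄) : NecessaryConditions p₁ p₂ p₃ p₄ ↔
    (p₁⁻¹).toReal + (p₂⁻¹).toReal + 2 * (p₃⁻¹).toReal + (p₄⁻¹).toReal ≤ 2 ∧
    2 * (p₁⁻¹).toReal + (p₂⁻¹).toReal + (p₃⁻¹).toReal + (p₄⁻¹).toReal ≤ 2 ∧
    (p₁⁻¹).toReal + 2 * (p₂⁻¹).toReal + (p₃⁻¹).toReal + 2 * (p₄⁻¹).toReal ≤ 2 := by
  have hcoe : ∀ {p : ℝ≥0∞}, 0 < p → ∃ a : NNReal, p⁻¹ = a := fun hp =>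
    ⟨_, (ENNReal.coe_toNNReal (ENNReal.inv_ne_top.mpr hp.ne')).symm⟩
  obtain ⟨a₁, ha₁⟩ := hcoe hp₁
  obtain ⟨a₂, ha₂⟩ := hcoe hp₂
  obtain ⟨a₃, ha₃⟩ := hcoe hp₃
  obtain ⟨a₄, ha₄⟩ := hcoe hp₄
  simp only [NecessaryConditions, div_eq_mul_inv, one_mul, ha₁, ha₂, ha₃, ha₄, ENNReal.coe_toReal]
  norm_cast

theorem diamond_le_mul_lpNorm {p₁ p₂ p₃ p₄ : ℝ≥0∞} (hp₁ : 0 < p₁) (hp₂ : 0 < p₂)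
    (hp₃ : 0 < p₃) (hp₄ : 0 < p₄) (h : NecessaryConditions p₁ p₂ p₃ p₄) {t : F} (ht : t ≠ 0)
    {f₁ f₂ f₃ f₄ : (Fin 2 → F) → ℝ} (hf₁ : ∀ x, 0 ≤ f₁ x) (hf₂ : ∀ x, 0 ≤ f₂ x)
    (hf₃ : ∀ x, 0 ≤ f₃ x) (hf₄ : ∀ x, 0 ≤ f₄ x) :
    diamond t f₁ f₂ f₃ f₄ ≤
      576 * (lpNorm p₁ f₁ * lpNorm p₂ f₂ * lpNorm p₃ f₃ * lpNorm p₄ f₄) := by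
  obtain ⟨h₁, h₂, h₃⟩ := (necessaryConditions_iff hp₁ hp₂ hp₃ hp₄).mp h
  obtain ⟨g₁, hg₁, hmean₁, hle₁⟩ := exists_le_lpNorm_mul_rpow hp₁ hf₁
  obtain ⟨g₂, hg₂, hmean₂, hle₂⟩ := exists_le_lpNorm_mul_rpow hp₂ hf₂
  obtain ⟨g₃, hg₃, hmean₃, hle₃⟩ := exists_le_lpNorm_mul_rpow hp₃ hf₃
  obtain ⟨g₄, hg₄, hmean₄, hle₄⟩ := exists_le_lpNorm_mul_rpow hp₄ hf₄
  set L := lpNorm p₁ f₁ * lpNorm p₂ f₂ * lpNorm p₃ f₃ * lpNorm p₄ f₄ with hL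
  have hL₀ : 0 ≤ L := mul_nonneg (mul_nonneg (mul_nonneg (lpNorm_nonneg _ _) (lpNorm_nonneg _ _))
    (lpNorm_nonneg _ _)) (lpNorm_nonneg _ _)
  calc diamond t f₁ f₂ f₃ f₄
      ≤ L * diamond t (fun x => g₁ x ^ (p₁⁻¹).toReal) (fun x => g₂ x ^ (p₂⁻¹).toReal)
          (fun x => g₃ x ^ (p₃⁻¹).toReal) fun x => g₄ x ^ (p₄⁻¹).toReal := by
        rw [diamond_eq, diamond_eq, mul_left_comm, hL, ← diamondSum_const_mul]
        gcongr
        exact diamondSum_mono (fun _ _ => circleInd_nonneg _ _) hf₁ hf₂ hf₃ hf₄ hle₁ hle₂ hle₃ hle₄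
    _ ≤ L * 576 := by
        gcongr
        exact diamond_rpow_le ht hg₁ hg₂ hg₃ hg₄ hmean₁ hmean₂ hmean₃ hmean₄ ENNReal.toReal_nonneg
          ENNReal.toReal_nonneg ENNReal.toReal_nonneg ENNReal.toReal_nonneg h₁ h₂ h₃
    _ = 576 * L := mul_comm _ _

end UpperBound

theorem NecessaryConditions.bounded {p₁ p₂ p₃ p₄ : ℝ≥0∞} (h : NecessaryConditions p₁ p₂ p₃ p₄)
    (hp₁ : 0 < p₁) (hp₂ : 0 < p₂) (hp₃ : 0 < p₃) (hp₄ : 0 < p₄) : Bounded p₁ p₂ p₃ p₄ :=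
  ⟨576, by norm_num, fun _ _ _ _ _ ht _ _ _ _ hf₁ hf₂ hf₃ hf₄ =>
    diamond_le_mul_lpNorm hp₁ hp₂ hp₃ hp₄ h ht hf₁ hf₂ hf₃ hf₄⟩

theorem indicator_one_nonneg {α : Type*} (s : Set α) (x : α) : (0 : ℝ) ≤ s.indicator 1 x :=
  Set.indicator_nonneg (fun _ _ => zero_le_one) x

theorem Bounded.restrictedBounded {p₁ p₂ p₃ p₄ : ℝ≥0∞} (h : Bounded p₁ p₂ p₃ p₄) :
    RestrictedBounded p₁ p₂ p₃ p₄ := by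
  obtain ⟨C, hC, hbound⟩ := h
  exact ⟨C, hC, fun F _ _ h3 t ht E₁ E₂ E₃ E₄ =>
    hbound F h3 t ht _ _ _ _ (indicator_one_nonneg E₁) (indicator_one_nonneg E₂)
      (indicator_one_nonneg E₃) (indicator_one_nonneg E₄)⟩

section Sharpness

theorem le_of_forall_pow_rpow_neg_le {b C σ τ : ℝ} (hb : 1 < b)
    (h : ∀ n : ℕ, n ≠ 0 → (b ^ n) ^ (-τ) ≤ C * (b ^ n) ^ (-σ)) : σ ≤ τ := by
  by_contra! hστ
  have hgrowth : Filter.Tendsto (fun n : ℕ => (b ^ (σ - τ)) ^ n) Filter.atTop Filter.atTop :=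
    tendsto_pow_atTop_atTop_of_one_lt (Real.one_lt_rpow hb (sub_pos.mpr hστ))
  obtain ⟨n, hlarge, hn⟩ :=
    ((hgrowth.eventually_gt_atTop C).and (Filter.eventually_ne_atTop 0)).exists
  have hq : 0 < b ^ n := pow_pos (zero_lt_one.trans hb) n
  have hcomm : (b ^ (σ - τ)) ^ n = (b ^ n) ^ σ * (b ^ n) ^ (-τ) := by
    rw [← Real.rpow_add hq, ← sub_eq_add_neg, Real.rpow_pow_comm (zero_lt_one.trans hb).le]
  refine hlarge.not_ge ?_
  calc (b ^ (σ - τ)) ^ n = (b ^ n) ^ σ * (b ^ n) ^ (-τ) := hcomm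
    _ ≤ (b ^ n) ^ σ * (C * (b ^ n) ^ (-σ)) := by
        gcongr
        exact h n hn
    _ = C := by
        rw [mul_left_comm, ← Real.rpow_add hq, add_neg_cancel, Real.rpow_zero, mul_one]

variable {F : Type} [Field F]

/-- The test sets for the necessity of the conditions: the dilates `e • S₁`, `e ∈ {0, 1, -1}`, over
a field of characteristic three. -/
def testSet (F : Type) [Field F] [Algebra (ZMod 3) F] (e : ZMod 3) : Set (Fin 2 → F) :=
  (e • ·) '' circle (1 : F)

/-- The codimension of `e • S₁` in the plane: a point for `e = 0`, a curve otherwise. -/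
def testCodim (e : ZMod 3) : ℕ := if e = 0 then 2 else 1

theorem circleInd_smul_sub_smul [Algebra (ZMod 3) F] {e e' : ZMod 3} (he : e ≠ e') {t : F}
    {v : Fin 2 → F} (hv : v ∈ circle t) : circleInd t (e • v - e' • v) = 1 := by
  have hsq : (e - e') ^ 2 = 1 := by
    revert e e'
    decide
  exact circleInd_of_eq (by rw [← sub_smul, quadNorm_smul, hsq, one_smul, mem_circle.mp hv])

variable [Fintype F]

theorem lpNorm_indicator_le {p : ℝ≥0∞} (hp : 0 < p) (E : Set (Fin 2 → F)) :
    lpNorm p (E.indicator 1) ≤ (((Fintype.card F : ℝ) ^ 2)⁻¹ * E.ncard) ^ (p⁻¹).toReal := by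
  classical
  by_cases htop : p = ∞
  · simp only [htop, lpNorm, if_true, ENNReal.inv_top, ENNReal.toReal_zero, Real.rpow_zero]
    refine ciSup_le fun x => ?_
    rw [abs_of_nonneg (indicator_one_nonneg E x)]
    exact Set.indicator_le_self' (fun _ _ => zero_le_one) x
  · have hP : p.toReal ≠ 0 := (ENNReal.toReal_pos hp.ne' htop).ne'
    have hsum : ∑ x, E.indicator (1 : (Fin 2 → F) → ℝ) x ^ p.toReal = E.ncard := by
      rw [Set.ncard_eq_toFinset_card']
      simp [Set.indicator_apply, ite_pow, hP]
    rw [lpNorm_of_ne_top htop (indicator_one_nonneg E), hsum]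

variable [Algebra (ZMod 3) F]

theorem ncard_testSet_mul_le (e : ZMod 3) :
    (testSet F e).ncard * Fintype.card F ^ testCodim e ≤ 2 * Fintype.card F ^ 2 := by
  unfold testCodim
  split_ifs with he
  · have hsub : testSet F e ⊆ {0} := by
      rintro _ ⟨v, -, rfl⟩
      simp [he]
    have hncard := (Set.ncard_le_ncard hsub).trans_eq (Set.ncard_singleton _)
    gcongr
    exact hncard.trans one_le_two
  · calc (testSet F e).ncard * Fintype.card F ^ 1
        ≤ 2 * Fintype.card F * Fintype.card F ^ 1 := by
          gcongr
          exact (Set.ncard_image_le).trans (ncard_circle_le 1)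
      _ = 2 * Fintype.card F ^ 2 := by ring

theorem lpNorm_testSet_le {p : ℝ≥0∞} (hp : 0 < p) (e : ZMod 3) :
    lpNorm p ((testSet F e).indicator 1) ≤
      2 ^ (p⁻¹).toReal * (Fintype.card F : ℝ) ^ (-(testCodim e * (p⁻¹).toReal)) := by
  have hq : 0 < (Fintype.card F : ℝ) := Nat.cast_pos.mpr Fintype.card_pos
  have hcount : ((testSet F e).ncard : ℝ) * Fintype.card F ^ testCodim e ≤ 2 * Fintype.card F ^ 2 :=
    by exact_mod_cast ncard_testSet_mul_le e
  have hdensity : ((Fintype.card F : ℝ) ^ 2)⁻¹ * (testSet F e).ncard ≤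
      2 * (Fintype.card F : ℝ) ^ (-testCodim e : ℝ) := by
    rw [Real.rpow_neg hq.le, Real.rpow_natCast, inv_mul_le_iff₀ (by positivity), ← mul_assoc,
      ← div_eq_mul_inv, le_div_iff₀ (by positivity)]
    linarith
  calc lpNorm p ((testSet F e).indicator 1)
      ≤ (((Fintype.card F : ℝ) ^ 2)⁻¹ * (testSet F e).ncard) ^ (p⁻¹).toReal :=
        lpNorm_indicator_le hp _
    _ ≤ (2 * (Fintype.card F : ℝ) ^ (-testCodim e : ℝ)) ^ (p⁻¹).toReal := by gcongr
    _ = _ := by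
        rw [Real.mul_rpow two_pos.le (by positivity), ← Real.rpow_mul hq.le, neg_mul]

variable {e₁ e₂ e₃ e₄ : ZMod 3} (h₁₂ : e₁ ≠ e₂) (h₂₃ : e₂ ≠ e₃) (h₃₄ : e₃ ≠ e₄) (h₄₁ : e₄ ≠ e₁)
  (h₁₃ : e₁ ≠ e₃)
include h₁₂ h₂₃ h₃₄ h₄₁ h₁₃

/-- The configurations `(e₁ • v, e₂ • v, e₃ • v, e₄ • v)` with `v ∈ S₁` are all counted, since
distinct elements of `ZMod 3` differ by `±1`. -/
theorem rpow_neg_two_le_diamond_testSet :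
    (Fintype.card F : ℝ) ^ (-2 : ℝ) ≤
      diamond (1 : F) ((testSet F e₁).indicator 1) ((testSet F e₂).indicator 1)
        ((testSet F e₃).indicator 1) ((testSet F e₄).indicator 1) := by
  classical
  have hq : 0 < (Fintype.card F : ℝ) := Nat.cast_pos.mpr Fintype.card_pos
  have hN : 0 < ((circle (1 : F)).ncard : ℝ) := Nat.cast_pos.mpr <|
    (Set.ncard_pos).mpr ⟨![1, 0], by simp [mem_circle, quadNorm_vec]⟩
  have hmem : ∀ e, ∀ v ∈ circle (1 : F),
      (testSet F e).indicator (1 : (Fin 2 → F) → ℝ) (e • v) = 1 := fun e v hv =>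
    Set.indicator_of_mem (Set.mem_image_of_mem _ hv) 1
  have hinj : Function.Injective fun v : Fin 2 → F => (e₁ • v, e₂ • v, e₃ • v, e₄ • v) :=
    fun v v' h => by
      obtain ⟨h₁, h₂, -, -⟩ : e₁ • v = e₁ • v' ∧ e₂ • v = e₂ • v' ∧ _ ∧ _ := by
        simpa only [Prod.mk.injEq] using h
      have : Fact (Nat.Prime 3) := ⟨Nat.prime_three⟩
      refine smul_right_injective _ (sub_ne_zero.mpr h₁₂) ?_
      simp only [sub_smul, h₁, h₂]
  have hcount : ((circle (1 : F)).ncard : ℝ) ≤ diamondSum (fun x y => circleInd (1 : F) (x - y))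
      ((testSet F e₁).indicator 1) ((testSet F e₂).indicator 1)
      ((testSet F e₃).indicator 1) ((testSet F e₄).indicator 1) := by
    rw [Set.ncard_eq_toFinset_card']
    refine card_le_diamondSum (fun _ _ => circleInd_nonneg _ _) (indicator_one_nonneg _)
      (indicator_one_nonneg _) (indicator_one_nonneg _) (indicator_one_nonneg _) hinj.injOn
      fun v hv => ?_
    have hv := Set.mem_toFinset.mp hv
    simp only [circleInd_smul_sub_smul h₁₂ hv, circleInd_smul_sub_smul h₂₃ hv,
      circleInd_smul_sub_smul h₃₄ hv, circleInd_smul_sub_smul h₄₁ hv,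
      circleInd_smul_sub_smul h₁₃ hv, hmem _ v hv, mul_one]
  rw [diamond_eq, Real.rpow_neg hq.le, Real.rpow_two, mul_inv, mul_assoc]
  refine le_mul_of_one_le_right (by positivity) ?_
  rwa [le_inv_mul_iff₀ hN, mul_one]

theorem Bounded.sum_testCodim_mul_le {p₁ p₂ p₃ p₄ : ℝ≥0∞} (h : Bounded p₁ p₂ p₃ p₄)
    (hp₁ : 0 < p₁) (hp₂ : 0 < p₂) (hp₃ : 0 < p₃) (hp₄ : 0 < p₄) :
    testCodim e₁ * (p₁⁻¹).toReal + testCodim e₂ * (p₂⁻¹).toReal +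
      testCodim e₃ * (p₃⁻¹).toReal + testCodim e₄ * (p₄⁻¹).toReal ≤ 2 := by
  obtain ⟨C, hC, hbound⟩ := h
  refine le_of_forall_pow_rpow_neg_le (b := 3)
    (C := C * 2 ^ ((p₁⁻¹).toReal + (p₂⁻¹).toReal + (p₃⁻¹).toReal + (p₄⁻¹).toReal))
    (by norm_num) fun n hn => ?_
  have : Fact (Nat.Prime 3) := ⟨Nat.prime_three⟩
  let K := GaloisField 3 n
  have : Fintype K := Fintype.ofFinite K
  have hcard : (Fintype.card K : ℝ) = 3 ^ n := by
    rw [← Nat.card_eq_fintype_card, GaloisField.card 3 n hn]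
    norm_num
  have hq : 0 < (Fintype.card K : ℝ) := Nat.cast_pos.mpr Fintype.card_pos
  have h3 : IsSquare (3 : K) := by
    rw [show (3 : K) = 0 by exact_mod_cast CharP.cast_eq_zero K 3]
    exact IsSquare.zero
  rw [← hcard]
  calc (Fintype.card K : ℝ) ^ (-2 : ℝ)
      ≤ diamond (1 : K) ((testSet K e₁).indicator 1) ((testSet K e₂).indicator 1)
          ((testSet K e₃).indicator 1) ((testSet K e₄).indicator 1) :=
        rpow_neg_two_le_diamond_testSet h₁₂ h₂₃ h₃₄ h₄₁ h₁₃
    _ ≤ C * (lpNorm p₁ ((testSet K e₁).indicator 1) * lpNorm p₂ ((testSet K e₂).indicator 1) *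
          lpNorm p₃ ((testSet K e₃).indicator 1) * lpNorm p₄ ((testSet K e₄).indicator 1)) :=
        hbound K h3 1 one_ne_zero _ _ _ _ (indicator_one_nonneg _) (indicator_one_nonneg _)
          (indicator_one_nonneg _) (indicator_one_nonneg _)
    _ ≤ _ := mul_le_mul_of_nonneg_left (mul_le_mul (mul_le_mul (mul_le_mul
          (lpNorm_testSet_le hp₁ e₁) (lpNorm_testSet_le hp₂ e₂) (lpNorm_nonneg _ _) (by positivity))
          (lpNorm_testSet_le hp₃ e₃) (lpNorm_nonneg _ _) (by positivity))
          (lpNorm_testSet_le hp₄ e₄) (lpNorm_nonneg _ _) (by positivity)) hC.le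
    _ = _ := by
        simp only [neg_add, Real.rpow_add two_pos, Real.rpow_add hq]
        ring

end Sharpness

theorem Bounded.necessaryConditions {p₁ p₂ p₃ p₄ : ℝ≥0∞} (h : Bounded p₁ p₂ p₃ p₄)
    (hp₁ : 0 < p₁) (hp₂ : 0 < p₂) (hp₃ : 0 < p₃) (hp₄ : 0 < p₄) :
    NecessaryConditions p₁ p₂ p₃ p₄ := by
  have hcodim := fun e₁ e₂ e₃ e₄ h₁₂ h₂₃ h₃₄ h₄₁ h₁₃ =>
    h.sum_testCodim_mul_le (e₁ := e₁) (e₂ := e₂) (e₃ := e₃) (e₄ := e₄) h₁₂ h₂₃ h₃₄ h₄₁ h₁₃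
      hp₁ hp₂ hp₃ hp₄
  have hzero : testCodim 0 = 2 := rfl
  have hone : testCodim 1 = 1 := rfl
  have htwo : testCodim 2 = 1 := rfl
  have h₁ := hcodim 1 2 0 2 (by decide) (by decide) (by decide) (by decide) (by decide)
  have h₂ := hcodim 0 2 1 2 (by decide) (by decide) (by decide) (by decide) (by decide)
  have h₃ := hcodim 1 0 2 0 (by decide) (by decide) (by decide) (by decide) (by decide)
  simp only [hzero, hone, htwo, Nat.cast_one, Nat.cast_ofNat, one_mul] at h₁ h₂ h₃
  exact (necessaryConditions_iff hp₁ hp₂ hp₃ hp₄).mpr ⟨h₁, h₂, h₃⟩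

theorem necessaryConditions_two_top_two_two : NecessaryConditions 2 ∞ 2 2 := by
  rw [necessaryConditions_iff two_pos ENNReal.zero_lt_top two_pos two_pos]
  norm_num

theorem necessaryConditions_two_two_two_top : NecessaryConditions 2 2 2 ∞ := by
  rw [necessaryConditions_iff two_pos two_pos two_pos ENNReal.zero_lt_top]
  norm_num

end DiamondForm

end

theorem theorem6p5_general {p₁ p₂ p₃ p₄ : ℝ≥0∞} (hp₁ : 0 < p₁) (hp₂ : 0 < p₂) (hp₃ : 0 < p₃)
    (hp₄ : 0 < p₄) :
    DiamondForm.Bounded p₁ p₂ p₃ p₄ ↔ DiamondForm.NecessaryConditions p₁ p₂ p₃ p₄ :=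
  ⟨fun h => h.necessaryConditions hp₁ hp₂ hp₃ hp₄, fun h => h.bounded hp₁ hp₂ hp₃ hp₄⟩

theorem theorem6p5 :
    (∀ p₁ p₂ p₃ p₄ : ℝ≥0∞, 1 ≤ p₁ → 1 ≤ p₂ → 1 ≤ p₃ → 1 ≤ p₄ →
      DiamondForm.Bounded p₁ p₂ p₃ p₄ → DiamondForm.NecessaryConditions p₁ p₂ p₃ p₄) ∧
    (∀ p₁ p₂ p₃ p₄ : ℝ≥0∞, 1 ≤ p₁ → 1 ≤ p₂ → 1 ≤ p₃ → 1 ≤ p₄ →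
      DiamondForm.NecessaryConditions p₁ p₂ p₃ p₄ →
      (p₁, p₂, p₃, p₄) ≠ (2, 2, 2, ∞) → (p₁, p₂, p₃, p₄) ≠ (2, ∞, 2, 2) →
      DiamondForm.Bounded p₁ p₂ p₃ p₄) ∧
    DiamondForm.RestrictedBounded 2 ∞ 2 2 ∧
    DiamondForm.RestrictedBounded 2 2 2 ∞ := by
  have hpos : ∀ {p : ℝ≥0∞}, 1 ≤ p → 0 < p := zero_lt_one.trans_le
  refine ⟨fun _ _ _ _ h₁ h₂ h₃ h₄ =>
      (theorem6p5_general (hpos h₁) (hpos h₂) (hpos h₃) (hpos h₄)).mp,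
    fun _ _ _ _ h₁ h₂ h₃ h₄ h _ _ =>
      (theorem6p5_general (hpos h₁) (hpos h₂) (hpos h₃) (hpos h₄)).mpr h, ?_, ?_⟩
  · exact (DiamondForm.necessaryConditions_two_top_two_two.bounded two_pos ENNReal.zero_lt_top
      two_pos two_pos).restrictedBounded
  · exact (DiamondForm.necessaryConditions_two_two_two_top.bounded two_pos two_pos two_pos
      ENNReal.zero_lt_top).restrictedBounded
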